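/- Let $\mathbb{D}=\{z\in\mathbb{C}:|z|<1\}$, let $dA=\frac1\pi\,dx\,dy$ be the normalized area measure on $\mathbb{D}$, and for $1\le p\le\infty$ let $L^p(\mathbb{D})$ be the space of complex-valued measurable functions $f$ on $\mathbb{D}$ with $\|f\|_p<\infty$, where $\|f\|_p=\left(\int_{\mathbb{D}}|f|^p\,dA\right)^{1/p}$ for $p<\infty$ and $\|f\|_\infty=\operatorname{ess\,sup}_{\mathbb{D}}|f|$. Let $\mathfrak{J}_0^*$ be the integral operator $$\mathfrak{J}_0^*[f](z)=\int_{\mathbb{D}}\frac{\bar w}{1-\bar w z}\,f(w)\,dA(w),\qquad z\in\mathbb{D},$$ which is the adjoint of $\mathfrak{J}_0[f](z)=\int_{\mathbb{D}}\frac{z}{1-\bar w z}f(w)\,dA(w)$. For $1\le p\le\infty$ write $\|\mathfrak{J}_0^*\|_p=\sup\{\|\mathfrak{J}_0^*[f]\|_p: f\in L^p(\mathbb{D}),\ \|f\|_p=1\}$, and let $G=\sum_{k=0}^\infty\frac{(-1)^k}{(2k+1)^2}\approx0.915966$ be Catalan's constant. Then, for every $1\le p\le\infty$, $\mathfrak{J}_0^*$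 maps $L^p(\mathbb{D})$ into itself, and (with $1/\infty=0$) $$\|\mathfrak{J}_0^*\|_p\le\left(\frac12\right)^{1/p}\left(\frac{1+2G}{\pi}\right)^{1-2/p}\quad\text{for } 2\le p\le\infty,$$ $$\|\mathfrak{J}_0^*\|_p\le\left(\frac12\right)^{1-1/p}\left(\frac4\pi\right)^{2/p-1}\quad\text{for } 1\le p\le2.$$ Equality holds for $p=1$ (in the second inequality), for $p=2$ (in both) and for $p=\infty$ (in the first). -/

import Mathlib

open MeasureTheory
open scoped ENNReal ComplexConjugate

noncomputable section

/-- The normalized area measure `dA = dx dy / π` on the unit disk of `ℂ`. -/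
def diskArea : Measure ℂ :=
  ENNReal.ofReal (1 / Real.pi) • volume.restrict (Metric.ball (0 : ℂ) 1)

/-- The kernel `z / (1 - conj w * z)` of the operator `J₀`. -/
def J0Kernel (z w : ℂ) : ℂ := z / (1 - conj w * z)

/-- The kernel `conj w / (1 - conj w * z)` of the adjoint operator `J₀*`. -/
def J0AdjKernel (z w : ℂ) : ℂ := conj w / (1 - conj w * z)

/-- The two kernels are Hermitian transposes of each other, that is, the integral operators
they define are adjoint to each other. -/
theorem J0AdjKernel_eq_conj (z w : ℂ) : J0AdjKernel z w = conj (J0Kernel w z) := by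
  simp [J0AdjKernel, J0Kernel, mul_comm]

/-- `J₀[f](z) = ∫_𝔻 z / (1 - conj w * z) * f(w) dA(w)`. -/
def J0 (f : ℂ → ℂ) (z : ℂ) : ℂ := ∫ w, J0Kernel z w * f w ∂diskArea

/-- The adjoint operator `J₀*[f](z) = ∫_𝔻 conj w / (1 - conj w * z) * f(w) dA(w)`. -/
def J0Adj (f : ℂ → ℂ) (z : ℂ) : ℂ := ∫ w, J0AdjKernel z w * f w ∂diskArea

/-- The norm `sup {‖T f‖_p : f ∈ L^p(𝔻), ‖f‖_p = 1}` of an operator on `L^p(𝔻)`, with values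
in `[0, ∞]`. -/
def LpOpNorm (p : ℝ≥0∞) (T : (ℂ → ℂ) → (ℂ → ℂ)) : ℝ≥0∞ :=
  ⨆ (f : ℂ → ℂ) (_ : MemLp f p diskArea) (_ : eLpNorm f p diskArea = 1),
    eLpNorm (T f) p diskArea

/-- Catalan's constant `∑ (-1)^k / (2k+1)^2 ≈ 0.915966`. -/
def catalanConst : ℝ := ∑' k : ℕ, (-1 : ℝ) ^ k / (2 * (k : ℝ) + 1) ^ 2

/-- The bound `(1/2)^(1/p) * ((1+2G)/π)^(1-2/p)`, where `1/∞ = 0`. -/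
def upperBoundGeTwo (p : ℝ≥0∞) : ℝ :=
  (1 / 2 : ℝ) ^ (1 / p).toReal *
    ((1 + 2 * catalanConst) / Real.pi) ^ (1 - 2 * (1 / p).toReal)

/-- The bound `(1/2)^(1-1/p) * (4/π)^(2/p-1)`. -/
def upperBoundLeTwo (p : ℝ≥0∞) : ℝ :=
  (1 / 2 : ℝ) ^ (1 - (1 / p).toReal) *
    (4 / Real.pi) ^ (2 * (1 / p).toReal - 1)

end

/-!
The kernel `K(z, w) = conj w / (1 - conj w * z)` of `J₀*` has modulus `‖w‖ |S(conj w * z)|²`, where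
`S(u) = ∑ cₙ uⁿ = (1 - u)^(-1/2)` and `cₙ = binom(2n, n) / 4ⁿ`. Parseval's identity on the disk
(`hasSum_integral_diskArea_norm_tsum_sq`) therefore evaluates both marginals of `|K|` as power
series with nonnegative coefficients in the modulus of the remaining variable:

* `∫ |K(z, w)| dA(w) = ∑ 2 cₙ² / (2n+3) ‖z‖^(2n)`, increasing to `∑ 2 cₙ² / (2n+3) = (1 + 2G)/π`;
* `∫ |K(z, w)| dA(z) = ‖w‖ ∑ cₙ² / (n+1) ‖w‖^(2n)`, increasing to `∑ cₙ² / (n+1) = 4/π`.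

The second sum telescopes, with partial sums `4 N c_N²`, to Wallis' limit. The first differs by a
telescoping series from half of `∑ cₙ² / (2n+1) = (2/π) ∫₀^{π/2} θ / sin θ dθ = 4G/π`.

These are the exact norms on `L^∞` and on `L¹`: the upper bounds are immediate, and they are
sharp by testing on a unimodular function aligned with `K(z₀, ·)` (for `p = ∞`, with `z₀` tending
to the boundary) and on normalized indicators of disks shrinking to `w₀` (for `p = 1`). On `L²` one
has `J₀*[f](z) = ∑ aₙ zⁿ` with `aₙ = ∫ conj w^(n+1) f dA`, so that
`‖J₀*[f]‖₂² = ∑ |aₙ|² / (n+1)`, while `∑ (n+2) |aₙ|² ≤ ‖f‖₂²` by Bessel's inequality; as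
`1/(n+1) ≤ (n+2)/2`, the norm is `1/√2`, attained at `f(w) = √2 w`.

The remaining exponents follow by Riesz–Thorin interpolation, which is derived from Hadamard's three
lines theorem for a bilinear form on simple functions (`norm_le_of_bilinear_interpolation`). For
`1 < p < 2` it is applied to the form with its arguments exchanged. A converse of Hölder's
inequality and the density of simple functions turn the estimate of the form into one of the
operator.
-/

/-! ### The Taylor coefficients of `(1 - u)^(-1/2)` -/

/-- The Taylor coefficients `∏_{i<n} (2i+1)/(2i+2) = binom(2n,n)/4^n` of `(1 - u)^(-1/2)`. -/
noncomputable def invSqrtCoeff (n : ℕ) : ℝ :=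
  ∏ i ∈ Finset.range n, (2 * (i : ℝ) + 1) / (2 * i + 2)

lemma invSqrtCoeff_zero : invSqrtCoeff 0 = 1 := by simp [invSqrtCoeff]

lemma invSqrtCoeff_succ (n : ℕ) :
    invSqrtCoeff (n + 1) = invSqrtCoeff n * ((2 * (n : ℝ) + 1) / (2 * n + 2)) :=
  Finset.prod_range_succ _ _

lemma invSqrtCoeff_pos (n : ℕ) : 0 < invSqrtCoeff n :=
  Finset.prod_pos fun i _ => by positivity

lemma invSqrtCoeff_le_one (n : ℕ) : invSqrtCoeff n ≤ 1 :=
  Finset.prod_le_one (fun i _ => by positivity) fun i _ => by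
    rw [div_le_one (by positivity)]; linarith

/-- Identifies `cₙ` with the coefficient in Mathlib's binomial series for `(1 - u)^(-1/2)`. -/
lemma ringChoose_eq_invSqrtCoeff (n : ℕ) :
    Ring.choose ((1 / 2 : ℂ) + n - 1) n = (invSqrtCoeff n : ℂ) := by
  rw [← Ring.multichoose_eq]
  have h : ∀ n : ℕ, (ascPochhammer ℂ n).eval (1 / 2 : ℂ) = n.factorial * (invSqrtCoeff n : ℂ) := by
    intro n
    induction n with
    | zero => simp [invSqrtCoeff_zero]
    | succ n ih =>
      rw [ascPochhammer_succ_eval, ih, invSqrtCoeff_succ, Nat.factorial_succ]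
      have : (n : ℂ) + 1 ≠ 0 := by exact_mod_cast Nat.succ_ne_zero n
      push_cast
      field_simp
      ring
  have h1 := Ring.factorial_nsmul_multichoose_eq_ascPochhammer (1 / 2 : ℂ) n
  rw [Polynomial.ascPochhammer_smeval_eq_eval, h n, nsmul_eq_mul] at h1
  exact mul_left_cancel₀ (by exact_mod_cast n.factorial_ne_zero) h1

lemma hasSum_invSqrtCoeff {u : ℂ} (hu : ‖u‖ < 1) :
    HasSum (fun n => (invSqrtCoeff n : ℂ) * u ^ n) (1 / (1 - u) ^ (1 / 2 : ℂ)) := by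
  have h := (Complex.one_div_one_sub_cpow_hasFPowerSeriesOnBall_zero (1 / 2)).hasSum
    (y := u) (by
      simpa [Metric.mem_eball, edist_zero_right, enorm_eq_nnnorm] using (by exact_mod_cast hu))
  have hc : ∀ n : ℕ, Ring.choose ((2 : ℂ)⁻¹ + n - 1) n = (invSqrtCoeff n : ℂ) := fun n => by
    simpa using ringChoose_eq_invSqrtCoeff n
  simpa [FormalMultilinearSeries.ofScalars_apply_eq, hc, mul_comm] using h

lemma norm_tsum_invSqrtCoeff_sq {u : ℂ} (hu : ‖u‖ < 1) :
    ‖∑' n, (invSqrtCoeff n : ℂ) * u ^ n‖ ^ 2 = 1 / ‖1 - u‖ := by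
  have h0 : 1 - u ≠ 0 := by
    intro h
    rw [← sub_eq_zero.1 h] at hu
    simp at hu
  rw [(hasSum_invSqrtCoeff hu).tsum_eq, norm_div, norm_one, div_pow, one_pow]
  congr 1
  have : (1 / 2 : ℂ) = ((1 / 2 : ℝ) : ℂ) := by norm_num
  rw [this, Complex.norm_cpow_real, ← Real.rpow_natCast, ← Real.rpow_mul (norm_nonneg _)]
  norm_num

/-- The Wallis product in terms of the coefficients. -/
lemma invSqrtCoeff_sq_mul_wallis (n : ℕ) :
    invSqrtCoeff n ^ 2 * (2 * n + 1) * Real.Wallis.W n = 1 := by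
  induction n with
  | zero => simp [invSqrtCoeff_zero, Real.Wallis.W]
  | succ n ih =>
    refine Eq.trans ?_ ih
    rw [invSqrtCoeff_succ, Real.Wallis.W_succ]
    push_cast
    field_simp
    ring

lemma tendsto_nat_div_two_mul_add_one :
    Filter.Tendsto (fun n : ℕ => (n : ℝ) / (2 * n + 1)) Filter.atTop (nhds (1 / 2)) := by
  have h := (tendsto_one_div_add_atTop_nhds_zero_nat (𝕜 := ℝ)).comp
    (Filter.tendsto_id.const_mul_atTop' (r := 2) (by norm_num) :
      Filter.Tendsto (fun n : ℕ => 2 * n) Filter.atTop Filter.atTop)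
  have h2 := ((h.const_sub 1).const_mul (1 / 2))
  simp only [sub_zero, mul_one] at h2
  refine h2.congr fun n => ?_
  simp only [Function.comp]
  push_cast
  field_simp
  ring

/-- Wallis' formula. -/
lemma tendsto_nat_mul_invSqrtCoeff_sq :
    Filter.Tendsto (fun n : ℕ => (n : ℝ) * invSqrtCoeff n ^ 2) Filter.atTop
      (nhds (1 / Real.pi)) := by
  have h := tendsto_nat_div_two_mul_add_one.div Real.Wallis.tendsto_W_nhds_pi_div_two
    (by positivity)
  have e : (1 / 2 : ℝ) / (Real.pi / 2) = 1 / Real.pi := by field_simp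
  rw [e] at h
  refine h.congr fun n => ?_
  have := Real.Wallis.W_pos n
  have h2 := invSqrtCoeff_sq_mul_wallis n
  simp only [Pi.div_apply]
  field_simp
  linear_combination (-n : ℝ) * h2

/-- The series telescopes: its `N`-th partial sum is `4 N c_N²`. -/
lemma hasSum_invSqrtCoeff_sq_div_add_one :
    HasSum (fun n : ℕ => invSqrtCoeff n ^ 2 / (n + 1)) (4 / Real.pi) := by
  rw [hasSum_iff_tendsto_nat_of_nonneg (fun n => by positivity)]
  have h := tendsto_nat_mul_invSqrtCoeff_sq.const_mul 4
  rw [mul_one_div] at h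
  refine h.congr fun N => ?_
  induction N with
  | zero => simp
  | succ n ih =>
    rw [Finset.sum_range_succ, ← ih, invSqrtCoeff_succ]
    push_cast
    field_simp
    ring

/-- The `N`-th partial sum is `2 N² c_N² / (2N + 1)`. -/
lemma hasSum_invSqrtCoeff_sq_telescope :
    HasSum (fun n : ℕ => 2 * invSqrtCoeff n ^ 2 / (2 * n + 3)
      - invSqrtCoeff n ^ 2 / (2 * n + 1) / 2) (1 / Real.pi) := by
  have key : ∀ n : ℕ, 2 * invSqrtCoeff n ^ 2 / (2 * n + 3)
      - invSqrtCoeff n ^ 2 / (2 * n + 1) / 2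
      = invSqrtCoeff n ^ 2 * ((6 * n + 1) / (2 * (2 * n + 1) * (2 * n + 3))) := by
    intro n; field_simp; ring
  rw [hasSum_iff_tendsto_nat_of_nonneg (fun n => by rw [key]; positivity)]
  have h := (tendsto_nat_mul_invSqrtCoeff_sq.mul tendsto_nat_div_two_mul_add_one).const_mul 2
  have e : 2 * (1 / Real.pi * (1 / 2)) = 1 / Real.pi := by ring
  rw [e] at h
  refine h.congr fun N => ?_
  induction N with
  | zero => simp
  | succ n ih =>
    rw [Finset.sum_range_succ, ← ih, invSqrtCoeff_succ]
    push_cast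
    field_simp
    ring

/-! ### Catalan's constant -/

lemma hasSum_invSqrtCoeff_real {s : ℝ} (hs : |s| < 1) :
    HasSum (fun n => invSqrtCoeff n * s ^ (2 * n)) (1 / √(1 - s ^ 2)) := by
  have hs2 : s ^ 2 < 1 := by rw [← sq_abs]; exact pow_lt_one₀ (abs_nonneg _) hs two_ne_zero
  have hu : ‖((s ^ 2 : ℝ) : ℂ)‖ < 1 := by
    rw [Complex.norm_real, Real.norm_eq_abs, abs_of_nonneg (sq_nonneg s)]; exact hs2
  have hsum : Summable (fun n => invSqrtCoeff n * s ^ (2 * n)) := by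
    have := (hasSum_invSqrtCoeff hu).summable
    rw [← Complex.summable_ofReal]
    refine this.congr fun n => ?_
    push_cast
    rw [pow_mul]
  have h := norm_tsum_invSqrtCoeff_sq hu
  have e : ∑' n, (invSqrtCoeff n : ℂ) * ((s ^ 2 : ℝ) : ℂ) ^ n
      = ((∑' n, invSqrtCoeff n * s ^ (2 * n) : ℝ) : ℂ) := by
    rw [Complex.ofReal_tsum]
    refine tsum_congr fun n => ?_
    push_cast
    rw [pow_mul]
  have h0 : 0 ≤ ∑' n, invSqrtCoeff n * s ^ (2 * n) :=
    tsum_nonneg fun n => mul_nonneg (invSqrtCoeff_pos n).le (by rw [pow_mul]; positivity)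
  rw [e, Complex.norm_real, Real.norm_eq_abs, sq_abs, ← Complex.ofReal_one, ← Complex.ofReal_sub,
    Complex.norm_real, Real.norm_eq_abs, abs_of_pos (by linarith)] at h
  have : ∑' n, invSqrtCoeff n * s ^ (2 * n) = 1 / √(1 - s ^ 2) := by
    rw [← Real.sqrt_sq h0, h, Real.sqrt_div zero_le_one, Real.sqrt_one]
  rw [← this]
  exact hsum.hasSum

/-- The Taylor series of the arcsine, obtained by integrating that of its derivative. -/
lemma hasSum_arcsin {x : ℝ} (hx0 : 0 ≤ x) (hx : x < 1) :
    HasSum (fun n : ℕ => invSqrtCoeff n * x ^ (2 * n + 1) / (2 * n + 1)) (Real.arcsin x) := by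
  have hI : ∫ s in (0 : ℝ)..x, 1 / √(1 - s ^ 2) = Real.arcsin x := by
    have hlt : ∀ s ∈ Set.uIcc 0 x, -1 < s ∧ s < 1 := fun s hs => by
      rw [Set.uIcc_of_le hx0] at hs
      exact ⟨by linarith [hs.1], by linarith [hs.2]⟩
    rw [intervalIntegral.integral_eq_sub_of_hasDerivAt (f := Real.arcsin)]
    · simp
    · intro s hs
      exact Real.hasDerivAt_arcsin (hlt s hs).1.ne' (hlt s hs).2.ne
    · refine ContinuousOn.intervalIntegrable ?_
      refine continuousOn_const.div (by fun_prop) fun s hs => ?_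
      have := hlt s hs
      exact (Real.sqrt_pos.2 (by nlinarith)).ne'
  rw [← hI]
  have hterm : ∀ n : ℕ, ∫ s in (0 : ℝ)..x, invSqrtCoeff n * s ^ (2 * n)
      = invSqrtCoeff n * x ^ (2 * n + 1) / (2 * n + 1) := by
    intro n
    rw [intervalIntegral.integral_const_mul, integral_pow]
    push_cast
    simp [mul_div_assoc]
  simp_rw [← hterm]
  refine intervalIntegral.hasSum_integral_of_dominated_convergence (fun n _ => (x ^ 2) ^ n)
    (fun n => by fun_prop) (fun n => ?_) ?_ ?_ ?_
  · refine Filter.Eventually.of_forall fun s hs => ?_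
    rw [Set.uIoc_of_le hx0] at hs
    rw [norm_mul, Real.norm_eq_abs, abs_of_pos (invSqrtCoeff_pos n), norm_pow, Real.norm_eq_abs,
      abs_of_pos hs.1, ← pow_mul]
    calc _ ≤ 1 * s ^ (2 * n) := by
          have := hs.1.le
          gcongr
          exact invSqrtCoeff_le_one n
      _ ≤ _ := by
          rw [one_mul]
          exact pow_le_pow_left₀ hs.1.le hs.2 _
  · exact Filter.Eventually.of_forall fun s _ =>
      summable_geometric_of_lt_one (sq_nonneg x) (by nlinarith)
  · simp
  · refine Filter.Eventually.of_forall fun s hs => ?_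
    rw [Set.uIoc_of_le hx0] at hs
    exact hasSum_invSqrtCoeff_real (by rw [abs_of_pos hs.1]; linarith [hs.2])

lemma integral_sin_pow_even_half (n : ℕ) :
    ∫ t in (0 : ℝ)..(Real.pi / 2), Real.sin t ^ (2 * n) = Real.pi / 2 * invSqrtCoeff n := by
  induction n with
  | zero => simp [invSqrtCoeff_zero]
  | succ n ih =>
    rw [mul_add, mul_one, integral_sin_pow, ih, invSqrtCoeff_succ]
    simp
    ring

/-- Termwise integration of the Taylor series of `arctan`. -/
lemma integral_arctan_div :
    ∫ u in (0 : ℝ)..1, Real.arctan u / u = catalanConst := by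
  rw [intervalIntegral.integral_of_le zero_le_one, integral_Ioc_eq_integral_Ioo]
  have hint : ∀ k : ℕ, ∫ u in Set.Ioo (0 : ℝ) 1, u ^ (2 * k) = 1 / (2 * k + 1) := by
    intro k
    rw [← integral_Ioc_eq_integral_Ioo, ← intervalIntegral.integral_of_le zero_le_one,
      integral_pow]
    simp
  have hI : ∀ k : ℕ, IntegrableOn (fun u : ℝ => u ^ (2 * k)) (Set.Ioo 0 1) := fun k =>
    ((continuous_pow _).integrableOn_Icc).mono_set Set.Ioo_subset_Icc_self
  have h := hasSum_integral_of_summable_integral_norm (μ := volume.restrict (Set.Ioo (0 : ℝ) 1))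
    (F := fun (k : ℕ) (u : ℝ) => (-1 : ℝ) ^ k / (2 * k + 1) * u ^ (2 * k))
    (fun k => (hI k).const_mul _) ?_
  · have e : ∀ k : ℕ, ∫ u in Set.Ioo (0 : ℝ) 1, (-1 : ℝ) ^ k / (2 * k + 1) * u ^ (2 * k)
        = (-1) ^ k / (2 * (k : ℝ) + 1) ^ 2 := fun k => by
      rw [integral_const_mul, hint]
      field_simp
    simp_rw [e] at h
    rw [catalanConst, h.tsum_eq]
    refine setIntegral_congr_fun measurableSet_Ioo fun u hu => ?_
    have hs := (Real.hasSum_arctan (x := u) (by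
      rw [Real.norm_eq_abs, abs_of_pos hu.1]; exact hu.2)).div_const u
    rw [← hs.tsum_eq]
    refine tsum_congr fun k => ?_
    have := hu.1.ne'
    push_cast
    rw [pow_succ]
    field_simp
  · have e : ∀ k : ℕ, ∫ u in Set.Ioo (0 : ℝ) 1, ‖(-1 : ℝ) ^ k / (2 * k + 1) * u ^ (2 * k)‖
        = 1 / (2 * (k : ℝ) + 1) ^ 2 := fun k => by
      have : ∀ u : ℝ, ‖(-1 : ℝ) ^ k / (2 * k + 1) * u ^ (2 * k)‖
          = 1 / (2 * k + 1) * u ^ (2 * k) := fun u => by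
        rw [norm_mul, norm_div, norm_pow, norm_neg, norm_one, one_pow, pow_mul,
          Real.norm_of_nonneg (by positivity : (0 : ℝ) ≤ 2 * k + 1),
          Real.norm_of_nonneg (by positivity : (0 : ℝ) ≤ (u ^ 2) ^ k)]
      simp_rw [this]
      rw [integral_const_mul, hint]
      field_simp
    simp_rw [e]
    refine Summable.of_nonneg_of_le (fun k => by positivity) (fun k => ?_)
      ((summable_nat_add_iff 1).2 (Real.summable_one_div_nat_pow.2 one_lt_two))
    push_cast
    gcongr
    linarith

/-- The substitution `θ = 2 arctan u`. -/
lemma integral_inv_sinc :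
    ∫ t in (0 : ℝ)..(Real.pi / 2), (Real.sinc t)⁻¹ = 2 * catalanConst := by
  have h := intervalIntegral.integral_comp_mul_deriv'' (a := 0) (b := 1)
    (f := fun u => 2 * Real.arctan u) (f' := fun u => 2 * (1 / (1 + u ^ 2)))
    (g := fun t => (Real.sinc t)⁻¹) (by fun_prop)
    (fun u _ => ((Real.hasDerivAt_arctan u).const_mul 2).hasDerivWithinAt)
    (by
      refine Continuous.continuousOn (continuous_const.mul
        (continuous_const.div (by fun_prop) fun u => by positivity)))
    (by
      refine Real.continuous_sinc.continuousOn.inv₀ ?_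
      rintro _ ⟨u, hu, rfl⟩
      rw [Set.uIcc_of_le zero_le_one] at hu
      rcases hu.1.eq_or_lt with rfl | h0
      · simp
      · have h1 := Real.arctan_pos.2 h0
        have h2 := Real.arctan_lt_pi_div_two u
        rw [Real.sinc_of_ne_zero (by positivity)]
        exact (div_pos (Real.sin_pos_of_pos_of_lt_pi (by linarith) (by linarith))
          (by positivity)).ne')
  simp only [Real.arctan_zero, mul_zero, Real.arctan_one] at h
  rw [show 2 * (Real.pi / 4) = Real.pi / 2 by ring] at h
  rw [← h, ← integral_arctan_div, ← intervalIntegral.integral_const_mul]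
  refine intervalIntegral.integral_congr_uIoo fun u hu => ?_
  rw [Set.uIoo_of_le zero_le_one] at hu
  have h1 := Real.arctan_pos.2 hu.1
  have hs : Real.sin (2 * Real.arctan u) = 2 * u / (1 + u ^ 2) := by
    rw [Real.sin_two_mul, Real.sin_arctan, Real.cos_arctan]
    have := Real.sq_sqrt (show 0 ≤ 1 + u ^ 2 by positivity)
    field_simp
    rw [this]
  simp only [Function.comp]
  rw [Real.sinc_of_ne_zero (by positivity), hs]
  have := hu.1
  field_simp

/-- Since `cₙ` is the mean of `sin^(2n)` over `[0, π/2]`, the sum is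
`(2/π) ∫ arcsin (sin θ) / sin θ`, that is `(2/π) ∫ θ / sin θ`. -/
lemma hasSum_invSqrtCoeff_sq_div_two_mul_add_one :
    HasSum (fun n : ℕ => invSqrtCoeff n ^ 2 / (2 * n + 1)) (4 * catalanConst / Real.pi) := by
  have hπ := Real.pi_pos
  have hle : (0 : ℝ) ≤ Real.pi / 2 := by positivity
  have hterm : ∀ n : ℕ, ∫ t in Set.Ioo (0 : ℝ) (Real.pi / 2),
      invSqrtCoeff n / (2 * n + 1) * Real.sin t ^ (2 * n)
      = Real.pi / 2 * (invSqrtCoeff n ^ 2 / (2 * n + 1)) := by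
    intro n
    rw [integral_const_mul, ← integral_Ioc_eq_integral_Ioo,
      ← intervalIntegral.integral_of_le hle, integral_sin_pow_even_half]
    ring
  have h := hasSum_integral_of_summable_integral_norm
    (μ := volume.restrict (Set.Ioo (0 : ℝ) (Real.pi / 2)))
    (F := fun (n : ℕ) (t : ℝ) => invSqrtCoeff n / (2 * n + 1) * Real.sin t ^ (2 * n))
    (fun n => ?_) ?_
  · simp_rw [hterm] at h
    have e : ∫ t in Set.Ioo (0 : ℝ) (Real.pi / 2),
        ∑' n : ℕ, invSqrtCoeff n / (2 * n + 1) * Real.sin t ^ (2 * n) = 2 * catalanConst := by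
      rw [← integral_inv_sinc, intervalIntegral.integral_of_le hle, integral_Ioc_eq_integral_Ioo]
      refine setIntegral_congr_fun measurableSet_Ioo fun t ht => ?_
      have hs : 0 < Real.sin t := Real.sin_pos_of_pos_of_lt_pi ht.1 (by linarith [ht.2])
      have hs1 : Real.sin t < 1 := by
        rw [← Real.sin_pi_div_two]
        exact Real.sin_lt_sin_of_lt_of_le_pi_div_two (by linarith [ht.1]) le_rfl ht.2
      have ha := (hasSum_arcsin hs.le hs1).div_const (Real.sin t)
      rw [Real.arcsin_sin (by linarith [ht.1]) ht.2.le] at ha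
      rw [Real.sinc_of_ne_zero ht.1.ne', inv_div, ← ha.tsum_eq]
      refine tsum_congr fun n => ?_
      rw [pow_succ]
      field_simp
    rw [e] at h
    have h2 := h.mul_left (2 / Real.pi)
    have e1 : ∀ x : ℝ, 2 / Real.pi * (Real.pi / 2 * x) = x := fun x => by field_simp
    simp_rw [e1] at h2
    rwa [show 2 / Real.pi * (2 * catalanConst) = 4 * catalanConst / Real.pi by ring] at h2
  · exact ((Continuous.integrableOn_Icc (by fun_prop)).mono_set Set.Ioo_subset_Icc_self)
  · have e : ∀ n : ℕ, ∫ t in Set.Ioo (0 : ℝ) (Real.pi / 2),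
        ‖invSqrtCoeff n / (2 * n + 1) * Real.sin t ^ (2 * n)‖
        = Real.pi / 2 * (invSqrtCoeff n ^ 2 / (2 * n + 1)) := by
      intro n
      rw [← hterm]
      refine setIntegral_congr_fun measurableSet_Ioo fun t ht => ?_
      have := (invSqrtCoeff_pos n).le
      rw [Real.norm_of_nonneg (by rw [pow_mul]; positivity)]
    simp_rw [e]
    refine Summable.mul_left _ (Summable.of_nonneg_of_le (fun n => by positivity) (fun n => ?_)
      hasSum_invSqrtCoeff_sq_div_add_one.summable)
    gcongr
    have : (0 : ℝ) ≤ n := n.cast_nonneg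
    linarith

lemma hasSum_two_mul_invSqrtCoeff_sq_div_two_mul_add_three :
    HasSum (fun n : ℕ => 2 * invSqrtCoeff n ^ 2 / (2 * n + 3))
      ((1 + 2 * catalanConst) / Real.pi) := by
  have h := hasSum_invSqrtCoeff_sq_telescope.add
    (hasSum_invSqrtCoeff_sq_div_two_mul_add_one.div_const 2)
  simp only [sub_add_cancel] at h
  convert h using 1
  field_simp
  ring

/-! ### Parseval on the disk -/

instance isProbabilityMeasure_diskArea : IsProbabilityMeasure diskArea := by
  constructor
  rw [diskArea, Measure.smul_apply, Measure.restrict_apply_univ, Complex.volume_ball]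
  simp only [ENNReal.ofReal_one, one_pow, one_mul, smul_eq_mul, one_div]
  rw [ENNReal.ofReal_inv_of_pos Real.pi_pos, ← ENNReal.ofReal_coe_nnreal, NNReal.coe_real_pi,
    ENNReal.inv_mul_cancel (by simpa using Real.pi_pos) ENNReal.ofReal_ne_top]

lemma ae_diskArea_norm_lt_one : ∀ᵐ w ∂diskArea, ‖w‖ < 1 := by
  refine (Measure.smul_absolutelyContinuous (c := ENNReal.ofReal (1 / Real.pi))).ae_le ?_
  filter_upwards [ae_restrict_mem (μ := volume)
    (Metric.isOpen_ball (x := (0 : ℂ)) (ε := 1)).measurableSet] with w hw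
  simpa using hw

lemma integral_diskArea {E : Type*} [NormedAddCommGroup E] [NormedSpace ℝ E] (f : ℂ → E) :
    ∫ w, f w ∂diskArea = (1 / Real.pi) • ∫ w in Metric.ball (0 : ℂ) 1, f w := by
  rw [diskArea, integral_smul_measure, ENNReal.toReal_ofReal (by positivity)]

lemma integral_diskArea_norm_pow (k : ℕ) :
    ∫ w, ‖w‖ ^ k ∂diskArea = 2 / ((k : ℝ) + 2) := by
  rw [integral_diskArea, ← integral_indicator Metric.isOpen_ball.measurableSet]
  have h1 : ∀ w : ℂ, (Metric.ball (0 : ℂ) 1).indicator (fun w => ‖w‖ ^ k) w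
      = (Set.Iio (1 : ℝ)).indicator (fun r => r ^ k) ‖w‖ := fun w => by
    by_cases h : ‖w‖ < 1
    · rw [Set.indicator_of_mem (by simpa using h), Set.indicator_of_mem (by simpa using h)]
    · rw [Set.indicator_of_notMem (by simpa using h), Set.indicator_of_notMem (by simpa using h)]
  simp_rw [h1]
  rw [integral_fun_norm_addHaar volume (fun r => (Set.Iio (1 : ℝ)).indicator (fun r => r ^ k) r)]
  have h2 : ∫ r in Set.Ioi (0 : ℝ), r ^ (Module.finrank ℝ ℂ - 1) •
      (Set.Iio (1 : ℝ)).indicator (fun r => r ^ k) r = 1 / (k + 2) := by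
    have : ∀ r : ℝ, r ^ (Module.finrank ℝ ℂ - 1) •
      (Set.Iio (1 : ℝ)).indicator (fun r => r ^ k) r
        = (Set.Iio (1 : ℝ)).indicator (fun r => r ^ (k + 1)) r := fun r => by
      by_cases h : r < 1 <;> simp [h, pow_succ, mul_comm]
    simp_rw [this]
    rw [setIntegral_indicator measurableSet_Iio, Set.Ioi_inter_Iio,
      ← integral_Ioc_eq_integral_Ioo, ← intervalIntegral.integral_of_le zero_le_one, integral_pow]
    push_cast
    simp
    ring
  rw [h2]
  simp [Measure.real, Complex.volume_ball]
  have := Real.pi_pos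
  field_simp

lemma integral_diskArea_rotate {E : Type*} [NormedAddCommGroup E] [NormedSpace ℝ E]
    (c : Circle) (f : ℂ → E) :
    ∫ w, f (c * w) ∂diskArea = ∫ w, f w ∂diskArea := by
  rw [integral_diskArea, integral_diskArea, ← integral_indicator Metric.isOpen_ball.measurableSet,
    ← integral_indicator Metric.isOpen_ball.measurableSet,
    ← (rotation c).measurePreserving.integral_comp
      (rotation c).toHomeomorph.measurableEmbedding ((Metric.ball (0 : ℂ) 1).indicator f)]
  congr 2
  ext w
  by_cases h : ‖w‖ < 1
  · rw [Set.indicator_of_mem (by simpa [Circle.norm_coe] using h),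
      Set.indicator_of_mem (by simpa [Circle.norm_coe] using h),
      rotation_apply]
  · rw [Set.indicator_of_notMem (by simpa [Circle.norm_coe] using h),
      Set.indicator_of_notMem (by simpa [Circle.norm_coe] using h)]

lemma integrable_diskArea_of_continuous {E : Type*} [NormedAddCommGroup E] {f : ℂ → E}
    (hf : Continuous f) : Integrable f diskArea := by
  refine Integrable.smul_measure ?_ ENNReal.ofReal_ne_top
  exact (hf.continuousOn.integrableOn_compact (isCompact_closedBall 0 1)).mono_set
    Metric.ball_subset_closedBall

/-- Orthogonality of the monomials on the disk with the radial weight `‖w‖ ^ a`. -/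
lemma integral_diskArea_monomial (a m n : ℕ) :
    ∫ w, (‖w‖ : ℂ) ^ a * (w ^ m * conj w ^ n) ∂diskArea
      = if m = n then ((2 / (a + 2 * n + 2) : ℝ) : ℂ) else 0 := by
  split_ifs with h
  · subst h
    have : ∀ w : ℂ, (‖w‖ : ℂ) ^ a * (w ^ m * conj w ^ m)
        = ((‖w‖ ^ (a + 2 * m) : ℝ) : ℂ) := fun w => by
      rw [← mul_pow, Complex.mul_conj, Complex.normSq_eq_norm_sq]
      push_cast
      rw [pow_add, pow_mul]
    simp_rw [this]
    rw [integral_complex_ofReal, integral_diskArea_norm_pow]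
    push_cast
    rfl
  · -- the rotation by the angle `π / (m - n)` multiplies the integrand by `-1`
    have hd : ((m : ℝ) - n) ≠ 0 := by
      rw [sub_ne_zero]; exact_mod_cast h
    set c : Circle := Circle.exp (Real.pi / (m - n)) with hc
    have hc2 : (c : ℂ) ^ m * conj (c : ℂ) ^ n = -1 := by
      rw [hc, Circle.coe_exp, ← Complex.exp_conj, ← Complex.exp_nat_mul, ← Complex.exp_nat_mul,
        ← Complex.exp_add, ← Complex.exp_pi_mul_I]
      congr 1
      have hd' : ((m : ℂ) - n) ≠ 0 := by exact_mod_cast hd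
      simp only [map_mul, Complex.conj_ofReal, Complex.conj_I]
      push_cast
      field_simp
      ring
    have h1 := integral_diskArea_rotate c (fun w => (‖w‖ : ℂ) ^ a * (w ^ m * conj w ^ n))
    have h2 : ∀ w : ℂ, ((‖(c : ℂ) * w‖ : ℝ) : ℂ) ^ a * (((c : ℂ) * w) ^ m * conj ((c : ℂ) * w) ^ n)
        = -((‖w‖ : ℂ) ^ a * (w ^ m * conj w ^ n)) := fun w => by
      rw [norm_mul, Circle.norm_coe, one_mul, map_mul, mul_pow, mul_pow]
      linear_combination ((‖w‖ : ℂ) ^ a * (w ^ m * conj w ^ n)) * hc2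
    simp_rw [h2] at h1
    rw [integral_neg] at h1
    exact self_eq_neg.1 h1.symm

/-- Parseval's identity on the disk with the radial weight `‖w‖ ^ a`. -/
lemma hasSum_integral_diskArea_norm_tsum_sq (a : ℕ) {b : ℕ → ℂ} (hb : Summable fun n => ‖b n‖) :
    HasSum (fun n : ℕ => ‖b n‖ ^ 2 * (2 / ((a : ℝ) + 2 * n + 2)))
      (∫ w, ‖w‖ ^ a * ‖∑' n, b n * w ^ n‖ ^ 2 ∂diskArea) := by
  -- expand the square into an absolutely convergent double series; only its diagonal survives
  set F : ℕ × ℕ → ℂ → ℂ := fun p w =>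
    (b p.1 * conj (b p.2)) * ((‖w‖ : ℂ) ^ a * (w ^ p.1 * conj w ^ p.2)) with hF
  have hcont : ∀ p, Continuous (F p) := fun p => by
    have : Continuous fun w : ℂ => (conj w : ℂ) := Complex.continuous_conj
    fun_prop
  have hbound : ∀ p, ∀ w : ℂ, ‖w‖ < 1 → ‖F p w‖ ≤ ‖b p.1‖ * ‖b p.2‖ := fun p w hw => by
    simp only [hF, norm_mul, norm_pow, RCLike.norm_conj, Complex.norm_real, norm_norm]
    have h1 : ‖w‖ ^ a ≤ 1 := pow_le_one₀ (norm_nonneg _) hw.le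
    have h2 : ‖w‖ ^ p.1 ≤ 1 := pow_le_one₀ (norm_nonneg _) hw.le
    have h3 : ‖w‖ ^ p.2 ≤ 1 := pow_le_one₀ (norm_nonneg _) hw.le
    refine mul_le_of_le_one_right (by positivity) ?_
    exact mul_le_one₀ h1 (by positivity) (mul_le_one₀ h2 (by positivity) h3)
  have hbb : Summable fun p : ℕ × ℕ => ‖b p.1‖ * ‖b p.2‖ :=
    hb.mul_of_nonneg hb (fun _ => norm_nonneg _) (fun _ => norm_nonneg _)
  have key := hasSum_integral_of_summable_integral_norm (μ := diskArea) (F := F)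
    (fun p => integrable_diskArea_of_continuous (hcont p)) (by
      refine Summable.of_nonneg_of_le (fun p => integral_nonneg fun _ => norm_nonneg _)
        (fun p => ?_) hbb
      calc ∫ w, ‖F p w‖ ∂diskArea ≤ ∫ _, ‖b p.1‖ * ‖b p.2‖ ∂diskArea :=
            integral_mono_ae (integrable_diskArea_of_continuous (hcont p)).norm
              (integrable_const _) (by
                filter_upwards [ae_diskArea_norm_lt_one] with w hw using hbound p w hw)
        _ = _ := by simp)
  have hterm : ∀ p : ℕ × ℕ, ∫ w, F p w ∂diskArea = if p.1 = p.2 then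
      ((‖b p.2‖ ^ 2 * (2 / ((a : ℝ) + 2 * p.2 + 2)) : ℝ) : ℂ) else 0 := fun p => by
    simp only [hF]
    rw [integral_const_mul, integral_diskArea_monomial]
    split_ifs with h
    · rw [h, Complex.mul_conj, Complex.normSq_eq_norm_sq]
      push_cast
      ring
    · simp
  simp_rw [hterm] at key
  have hint : ∫ w, ∑' p, F p w ∂diskArea
      = ((∫ w, ‖w‖ ^ a * ‖∑' n, b n * w ^ n‖ ^ 2 ∂diskArea : ℝ) : ℂ) := by
    rw [← integral_complex_ofReal]
    refine integral_congr_ae ?_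
    filter_upwards [ae_diskArea_norm_lt_one] with w hw
    have hs : Summable fun n => ‖b n * w ^ n‖ := by
      refine Summable.of_nonneg_of_le (fun n => norm_nonneg _) (fun n => ?_) hb
      rw [norm_mul, norm_pow]
      exact mul_le_of_le_one_right (norm_nonneg _) (pow_le_one₀ (norm_nonneg _) hw.le)
    have hs' : Summable fun n => ‖conj (b n * w ^ n)‖ := by simpa using hs
    have hprod := tsum_mul_tsum_of_summable_norm hs hs'
    rw [← Complex.conj_tsum, RCLike.mul_conj] at hprod
    push_cast
    rw [show ((‖∑' n, b n * w ^ n‖ : ℝ) : ℂ) ^ 2 = _ from hprod, ← tsum_mul_left]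
    refine tsum_congr fun p => ?_
    simp only [hF, map_mul, map_pow]
    ring
  rw [hint] at key
  have hinj : Function.Injective (fun n : ℕ => (n, n)) := fun m n h => (Prod.ext_iff.1 h).1
  rw [← hinj.hasSum_iff] at key
  · simp only [Function.comp_def, if_true] at key
    exact Complex.hasSum_ofReal.1 key
  · rintro ⟨m, n⟩ h
    simp only [Set.mem_range, Prod.mk.injEq, not_exists, not_and] at h
    exact if_neg fun e => h m rfl e

/-! ### The kernel and the bounds on `L¹` and `L^∞` -/

lemma measurable_J0AdjKernel : Measurable fun p : ℂ × ℂ => J0AdjKernel p.1 p.2 := by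
  have : Measurable fun w : ℂ => (conj w : ℂ) := Complex.continuous_conj.measurable
  unfold J0AdjKernel
  fun_prop

lemma one_sub_norm_le_norm_one_sub_conj_mul {z w : ℂ} (hw : ‖w‖ < 1) :
    1 - ‖z‖ ≤ ‖1 - conj w * z‖ := by
  have h1 := norm_sub_norm_le (1 : ℂ) (conj w * z)
  rw [norm_one, norm_mul, RCLike.norm_conj] at h1
  have := mul_le_of_le_one_left (norm_nonneg z) hw.le
  linarith

lemma norm_J0AdjKernel_le {z w : ℂ} (hz : ‖z‖ < 1) (hw : ‖w‖ < 1) :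
    ‖J0AdjKernel z w‖ ≤ 1 / (1 - ‖z‖) := by
  rw [J0AdjKernel, norm_div, RCLike.norm_conj]
  exact div_le_div₀ zero_le_one hw.le (by linarith) (one_sub_norm_le_norm_one_sub_conj_mul hw)

lemma norm_J0AdjKernel_eq {z w : ℂ} (h : ‖conj w * z‖ < 1) :
    ‖J0AdjKernel z w‖ = ‖w‖ * ‖∑' n, (invSqrtCoeff n : ℂ) * (conj w * z) ^ n‖ ^ 2 := by
  rw [norm_tsum_invSqrtCoeff_sq h, J0AdjKernel, norm_div, RCLike.norm_conj, mul_one_div]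

lemma summable_norm_invSqrtCoeff_mul_pow {z : ℂ} (hz : ‖z‖ < 1) :
    Summable fun n => ‖(invSqrtCoeff n : ℂ) * z ^ n‖ := by
  refine Summable.of_nonneg_of_le (fun n => norm_nonneg _) (fun n => ?_)
    (summable_geometric_of_lt_one (norm_nonneg z) hz)
  rw [norm_mul, norm_pow, Complex.norm_real, Real.norm_of_nonneg (invSqrtCoeff_pos n).le]
  exact mul_le_of_le_one_left (by positivity) (invSqrtCoeff_le_one n)

lemma norm_conj_mul_lt_one {z w : ℂ} (hz : ‖z‖ < 1) (hw : ‖w‖ < 1) : ‖conj w * z‖ < 1 := by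
  rw [norm_mul, RCLike.norm_conj]
  exact mul_lt_one_of_nonneg_of_lt_one_left (norm_nonneg _) hw hz.le

/-- The variant of `norm_J0AdjKernel_eq` whose series is a power series in `w` rather than in
`conj w`. -/
lemma norm_J0AdjKernel_eq' {z w : ℂ} (h : ‖conj z * w‖ < 1) :
    ‖J0AdjKernel z w‖ = ‖w‖ * ‖∑' n, (invSqrtCoeff n : ℂ) * (conj z * w) ^ n‖ ^ 2 := by
  rw [norm_tsum_invSqrtCoeff_sq h, J0AdjKernel, norm_div, RCLike.norm_conj, mul_one_div,
    ← RCLike.norm_conj (1 - conj w * z)]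
  simp [mul_comm]

lemma norm_invSqrtCoeff_mul_pow_sq (z : ℂ) (n : ℕ) :
    ‖(invSqrtCoeff n : ℂ) * z ^ n‖ ^ 2 = invSqrtCoeff n ^ 2 * (‖z‖ ^ 2) ^ n := by
  rw [norm_mul, norm_pow, Complex.norm_real, Real.norm_eq_abs, mul_pow, sq_abs, ← pow_mul,
    ← pow_mul, mul_comm n 2]

lemma hasSum_integral_norm_J0AdjKernel_right {z : ℂ} (hz : ‖z‖ < 1) :
    HasSum (fun n : ℕ => 2 * invSqrtCoeff n ^ 2 / (2 * n + 3) * (‖z‖ ^ 2) ^ n)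
      (∫ w, ‖J0AdjKernel z w‖ ∂diskArea) := by
  have hz' : ‖conj z‖ < 1 := by rwa [RCLike.norm_conj]
  have h := hasSum_integral_diskArea_norm_tsum_sq 1 (summable_norm_invSqrtCoeff_mul_pow hz')
  have e : ∫ w, ‖J0AdjKernel z w‖ ∂diskArea
      = ∫ w, ‖w‖ ^ 1 * ‖∑' n, (invSqrtCoeff n : ℂ) * conj z ^ n * w ^ n‖ ^ 2 ∂diskArea := by
    refine integral_congr_ae ?_
    filter_upwards [ae_diskArea_norm_lt_one] with w hw
    rw [norm_J0AdjKernel_eq' (norm_conj_mul_lt_one hw hz), pow_one]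
    simp only [mul_pow, mul_assoc]
  rw [e]
  have ht : ∀ n : ℕ, 2 * invSqrtCoeff n ^ 2 / (2 * n + 3) * (‖z‖ ^ 2) ^ n
      = ‖(invSqrtCoeff n : ℂ) * conj z ^ n‖ ^ 2 * (2 / (((1 : ℕ) : ℝ) + 2 * n + 2)) := fun n => by
    rw [norm_invSqrtCoeff_mul_pow_sq, RCLike.norm_conj]
    push_cast
    field_simp
    ring
  simpa only [ht] using h

lemma hasSum_integral_norm_J0AdjKernel_left {w : ℂ} (hw : ‖w‖ < 1) :
    HasSum (fun n : ℕ => ‖w‖ * (invSqrtCoeff n ^ 2 / (n + 1) * (‖w‖ ^ 2) ^ n))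
      (∫ z, ‖J0AdjKernel z w‖ ∂diskArea) := by
  have hw' : ‖conj w‖ < 1 := by rwa [RCLike.norm_conj]
  have h := (hasSum_integral_diskArea_norm_tsum_sq 0
    (summable_norm_invSqrtCoeff_mul_pow hw')).mul_left ‖w‖
  have e : ∫ z, ‖J0AdjKernel z w‖ ∂diskArea
      = ‖w‖ * ∫ z, ‖z‖ ^ 0 * ‖∑' n, (invSqrtCoeff n : ℂ) * conj w ^ n * z ^ n‖ ^ 2 ∂diskArea := by
    rw [← integral_const_mul]
    refine integral_congr_ae ?_
    filter_upwards [ae_diskArea_norm_lt_one] with z hz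
    rw [norm_J0AdjKernel_eq (norm_conj_mul_lt_one hz hw), pow_zero, one_mul]
    simp only [mul_pow, mul_assoc]
  rw [e]
  have ht : ∀ n : ℕ, ‖w‖ * (invSqrtCoeff n ^ 2 / (n + 1) * (‖w‖ ^ 2) ^ n)
      = ‖w‖ * (‖(invSqrtCoeff n : ℂ) * conj w ^ n‖ ^ 2 * (2 / (((0 : ℕ) : ℝ) + 2 * n + 2))) :=
    fun n => by
      rw [norm_invSqrtCoeff_mul_pow_sq, RCLike.norm_conj]
      push_cast
      field_simp
      ring
  simpa only [ht] using h

lemma integral_norm_J0AdjKernel_right_le {z : ℂ} (hz : ‖z‖ < 1) :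
    ∫ w, ‖J0AdjKernel z w‖ ∂diskArea ≤ (1 + 2 * catalanConst) / Real.pi :=
  hasSum_le (fun n => mul_le_of_le_one_right (by positivity)
    (pow_le_one₀ (by positivity) (pow_le_one₀ (norm_nonneg _) hz.le)))
    (hasSum_integral_norm_J0AdjKernel_right hz)
    hasSum_two_mul_invSqrtCoeff_sq_div_two_mul_add_three

lemma integral_norm_J0AdjKernel_left_le {w : ℂ} (hw : ‖w‖ < 1) :
    ∫ z, ‖J0AdjKernel z w‖ ∂diskArea ≤ 4 / Real.pi :=
  hasSum_le (fun n => (mul_le_of_le_one_left (by positivity) hw.le).trans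
      (mul_le_of_le_one_right (by positivity)
        (pow_le_one₀ (by positivity) (pow_le_one₀ (norm_nonneg _) hw.le))))
    (hasSum_integral_norm_J0AdjKernel_left hw) hasSum_invSqrtCoeff_sq_div_add_one

lemma tendsto_sq_nhdsLT_one :
    Filter.Tendsto (fun r : ℝ => r ^ 2) (nhdsWithin 1 (Set.Iio 1)) (nhdsWithin 1 (Set.Iio 1)) := by
  refine tendsto_nhdsWithin_iff.2 ⟨?_, ?_⟩
  · have : Filter.Tendsto (fun r : ℝ => r ^ 2) (nhds 1) (nhds (1 ^ 2)) :=
      (continuous_pow 2).tendsto 1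
    rw [one_pow] at this
    exact this.mono_left nhdsWithin_le_nhds
  · filter_upwards [Ioo_mem_nhdsLT (show (0 : ℝ) < 1 by norm_num)] with r hr
    exact pow_lt_one₀ hr.1.le hr.2 two_ne_zero

/-- Abel's limit theorem for the power series in `r ^ 2`. -/
lemma tendsto_integral_norm_J0AdjKernel_right :
    Filter.Tendsto (fun r : ℝ => ∫ w, ‖J0AdjKernel r w‖ ∂diskArea) (nhdsWithin 1 (Set.Iio 1))
      (nhds ((1 + 2 * catalanConst) / Real.pi)) := by
  refine ((Real.tendsto_tsum_powerSeries_nhdsWithin_lt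
    hasSum_two_mul_invSqrtCoeff_sq_div_two_mul_add_three.tendsto_sum_nat).comp
      tendsto_sq_nhdsLT_one).congr' ?_
  filter_upwards [Ioo_mem_nhdsLT (show (0 : ℝ) < 1 by norm_num)] with r hr
  have h1 : ‖(r : ℂ)‖ = r := by rw [Complex.norm_real, Real.norm_of_nonneg hr.1.le]
  have := hasSum_integral_norm_J0AdjKernel_right (z := r) (by rw [h1]; exact hr.2)
  rw [h1] at this
  exact this.tsum_eq

lemma tendsto_integral_norm_J0AdjKernel_left :
    Filter.Tendsto (fun r : ℝ => ∫ z, ‖J0AdjKernel z r‖ ∂diskArea) (nhdsWithin 1 (Set.Iio 1))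
      (nhds (4 / Real.pi)) := by
  have h := (Filter.Tendsto.mono_left (Filter.tendsto_id (x := nhds (1 : ℝ)))
    nhdsWithin_le_nhds).mul ((Real.tendsto_tsum_powerSeries_nhdsWithin_lt
    hasSum_invSqrtCoeff_sq_div_add_one.tendsto_sum_nat).comp tendsto_sq_nhdsLT_one)
  rw [one_mul] at h
  refine h.congr' ?_
  filter_upwards [Ioo_mem_nhdsLT (show (0 : ℝ) < 1 by norm_num)] with r hr
  have h1 : ‖(r : ℂ)‖ = r := by rw [Complex.norm_real, Real.norm_of_nonneg hr.1.le]
  have := hasSum_integral_norm_J0AdjKernel_left (w := r) (by rw [h1]; exact hr.2)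
  rw [h1] at this
  rw [← this.tsum_eq, tsum_mul_left]
  rfl

lemma measurable_J0AdjKernel_right (z : ℂ) : Measurable (J0AdjKernel z) :=
  measurable_J0AdjKernel.comp measurable_prodMk_left

lemma measurable_J0AdjKernel_left (w : ℂ) : Measurable fun z => J0AdjKernel z w :=
  measurable_J0AdjKernel.comp measurable_prodMk_right

lemma integrable_J0AdjKernel_mul {f : ℂ → ℂ} (hf : Integrable f diskArea) {z : ℂ} (hz : ‖z‖ < 1) :
    Integrable (fun w => J0AdjKernel z w * f w) diskArea := by
  refine hf.bdd_mul (c := 1 / (1 - ‖z‖)) (measurable_J0AdjKernel_right z).aestronglyMeasurable ?_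
  filter_upwards [ae_diskArea_norm_lt_one] with w hw using norm_J0AdjKernel_le hz hw

lemma lintegral_enorm_J0AdjKernel_right_le {z : ℂ} (hz : ‖z‖ < 1) :
    ∫⁻ w, ‖J0AdjKernel z w‖ₑ ∂diskArea ≤ ENNReal.ofReal ((1 + 2 * catalanConst) / Real.pi) := by
  have h := integrable_J0AdjKernel_mul (integrable_const (1 : ℂ)) hz
  simp only [mul_one] at h
  rw [← ofReal_integral_norm_eq_lintegral_enorm h]
  exact ENNReal.ofReal_le_ofReal (integral_norm_J0AdjKernel_right_le hz)

lemma integrable_J0AdjKernel_left {w : ℂ} (hw : ‖w‖ < 1) :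
    Integrable (fun z => J0AdjKernel z w) diskArea := by
  refine Integrable.of_bound (measurable_J0AdjKernel_left w).aestronglyMeasurable
    (1 / (1 - ‖w‖)) ?_
  filter_upwards [ae_diskArea_norm_lt_one] with z hz
  rw [J0AdjKernel, norm_div, RCLike.norm_conj]
  refine div_le_div₀ zero_le_one hw.le (by linarith) ?_
  have := one_sub_norm_le_norm_one_sub_conj_mul (z := conj w) (w := conj z)
    (by rwa [RCLike.norm_conj])
  rwa [RCLike.norm_conj, Complex.conj_conj, mul_comm z] at this

lemma lintegral_enorm_J0AdjKernel_left_le {w : ℂ} (hw : ‖w‖ < 1) :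
    ∫⁻ z, ‖J0AdjKernel z w‖ₑ ∂diskArea ≤ ENNReal.ofReal (4 / Real.pi) := by
  rw [← ofReal_integral_norm_eq_lintegral_enorm (integrable_J0AdjKernel_left hw)]
  exact ENNReal.ofReal_le_ofReal (integral_norm_J0AdjKernel_left_le hw)

lemma aestronglyMeasurable_J0AdjKernel_mul {f : ℂ → ℂ} (hf : AEStronglyMeasurable f diskArea) :
    AEStronglyMeasurable (fun p : ℂ × ℂ => J0AdjKernel p.1 p.2 * f p.2)
      (diskArea.prod diskArea) :=
  measurable_J0AdjKernel.aestronglyMeasurable.mul hf.comp_snd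

lemma aestronglyMeasurable_J0Adj {f : ℂ → ℂ} (hf : AEStronglyMeasurable f diskArea) :
    AEStronglyMeasurable (J0Adj f) diskArea :=
  (aestronglyMeasurable_J0AdjKernel_mul hf).integral_prod_right'

lemma eLpNorm_one_J0Adj_le {f : ℂ → ℂ} (hf : AEStronglyMeasurable f diskArea) :
    eLpNorm (J0Adj f) 1 diskArea ≤ ENNReal.ofReal (4 / Real.pi) * eLpNorm f 1 diskArea := by
  rw [eLpNorm_one_eq_lintegral_enorm, eLpNorm_one_eq_lintegral_enorm]
  calc ∫⁻ z, ‖J0Adj f z‖ₑ ∂diskArea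
      ≤ ∫⁻ z, ∫⁻ w, ‖J0AdjKernel z w * f w‖ₑ ∂diskArea ∂diskArea :=
        lintegral_mono fun z => enorm_integral_le_lintegral_enorm _
    _ = ∫⁻ w, ∫⁻ z, ‖J0AdjKernel z w * f w‖ₑ ∂diskArea ∂diskArea :=
        lintegral_lintegral_swap (aestronglyMeasurable_J0AdjKernel_mul hf).enorm
    _ ≤ ∫⁻ w, ENNReal.ofReal (4 / Real.pi) * ‖f w‖ₑ ∂diskArea := by
        refine lintegral_mono_ae ?_
        filter_upwards [ae_diskArea_norm_lt_one] with w hw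
        simp_rw [enorm_mul]
        rw [lintegral_mul_const _ (measurable_J0AdjKernel_left w).enorm]
        gcongr
        exact lintegral_enorm_J0AdjKernel_left_le hw
    _ = _ := lintegral_const_mul'' _ hf.enorm

lemma eLpNorm_top_J0Adj_le (f : ℂ → ℂ) :
    eLpNorm (J0Adj f) ∞ diskArea
      ≤ ENNReal.ofReal ((1 + 2 * catalanConst) / Real.pi) * eLpNorm f ∞ diskArea := by
  simp only [eLpNorm_exponent_top]
  refine essSup_le_of_ae_le _ ?_
  filter_upwards [ae_diskArea_norm_lt_one] with z hz
  calc ‖J0Adj f z‖ₑ ≤ ∫⁻ w, ‖J0AdjKernel z w * f w‖ₑ ∂diskArea :=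
        enorm_integral_le_lintegral_enorm _
    _ ≤ ∫⁻ w, ‖J0AdjKernel z w‖ₑ * eLpNormEssSup f diskArea ∂diskArea := by
        refine lintegral_mono_ae ?_
        filter_upwards [enorm_ae_le_eLpNormEssSup f diskArea] with w hw
        rw [enorm_mul]
        gcongr
    _ = (∫⁻ w, ‖J0AdjKernel z w‖ₑ ∂diskArea) * eLpNormEssSup f diskArea :=
        lintegral_mul_const _ (measurable_J0AdjKernel_right z).enorm
    _ ≤ _ := by
        gcongr
        exact lintegral_enorm_J0AdjKernel_right_le hz

/-! ### The norm on `L²` -/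

lemma sq_toReal_eLpNorm_two {α E : Type*} [MeasurableSpace α] {μ : Measure α}
    [NormedAddCommGroup E] {f : α → E} (hf : MemLp f 2 μ) :
    (eLpNorm f 2 μ).toReal ^ 2 = ∫ x, ‖f x‖ ^ 2 ∂μ := by
  rw [hf.eLpNorm_eq_integral_rpow_norm two_ne_zero ENNReal.ofNat_ne_top]
  have h0 : 0 ≤ ∫ x, ‖f x‖ ^ 2 ∂μ := integral_nonneg fun _ => by positivity
  simp only [ENNReal.toReal_ofNat, Real.rpow_ofNat]
  rw [ENNReal.toReal_ofReal (by positivity), ← Real.rpow_natCast, ← Real.rpow_mul h0]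
  norm_num

/-- The coefficients of the power series of `J0Adj f`. -/
noncomputable def J0AdjCoeff (f : ℂ → ℂ) (n : ℕ) : ℂ := ∫ w, conj w ^ (n + 1) * f w ∂diskArea

lemma integrable_conj_pow_mul {f : ℂ → ℂ} (hf : Integrable f diskArea) (n : ℕ) :
    Integrable (fun w => conj w ^ n * f w) diskArea := by
  refine hf.bdd_mul (c := 1) (Complex.continuous_conj.pow n).aestronglyMeasurable ?_
  filter_upwards [ae_diskArea_norm_lt_one] with w hw
  rw [norm_pow, RCLike.norm_conj]
  exact pow_le_one₀ (norm_nonneg _) hw.le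

/-- The power series of `J₀*[f]`, from the geometric expansion of the kernel. -/
lemma hasSum_J0Adj {f : ℂ → ℂ} (hf : Integrable f diskArea) {z : ℂ} (hz : ‖z‖ < 1) :
    HasSum (fun n => J0AdjCoeff f n * z ^ n) (J0Adj f z) := by
  have h := hasSum_integral_of_summable_integral_norm (μ := diskArea)
    (F := fun (n : ℕ) w => (conj w ^ (n + 1) * f w) * z ^ n)
    (fun n => (integrable_conj_pow_mul hf (n + 1)).mul_const _) (by
      refine Summable.of_nonneg_of_le (fun n => integral_nonneg fun _ => norm_nonneg _)
        (fun n => ?_) ((summable_geometric_of_lt_one (norm_nonneg z) hz).mul_left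
          (∫ w, ‖f w‖ ∂diskArea))
      rw [← integral_mul_const]
      refine integral_mono_ae ((integrable_conj_pow_mul hf (n + 1)).mul_const _).norm
        (hf.norm.mul_const _) ?_
      filter_upwards [ae_diskArea_norm_lt_one] with w hw
      rw [norm_mul, norm_mul, norm_pow, norm_pow, RCLike.norm_conj]
      gcongr
      exact mul_le_of_le_one_left (norm_nonneg _) (pow_le_one₀ (norm_nonneg _) hw.le))
  simp_rw [integral_mul_const] at h
  have e : J0Adj f z = ∫ w, ∑' n : ℕ, (conj w ^ (n + 1) * f w) * z ^ n ∂diskArea := by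
    refine integral_congr_ae ?_
    filter_upwards [ae_diskArea_norm_lt_one] with w hw
    have hg := (hasSum_geometric_of_norm_lt_one (norm_conj_mul_lt_one hz hw)).mul_left
      (conj w * f w)
    rw [J0AdjKernel, div_mul_eq_mul_div, div_eq_mul_inv, ← hg.tsum_eq]
    refine tsum_congr fun n => ?_
    ring
  rw [e]
  exact h

/-- The normalized monomials `√(n+1) w ^ n`, an orthonormal family in `L²(𝔻)`. -/
noncomputable def diskMonomial (n : ℕ) (w : ℂ) : ℂ := (√((n : ℝ) + 1) : ℂ) * w ^ n

lemma memLp_diskMonomial (n : ℕ) (p : ℝ≥0∞) : MemLp (diskMonomial n) p diskArea := by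
  have hc : Continuous (diskMonomial n) := by unfold diskMonomial; fun_prop
  refine MemLp.of_bound hc.aestronglyMeasurable (√((n : ℝ) + 1)) ?_
  filter_upwards [ae_diskArea_norm_lt_one] with w hw
  rw [diskMonomial, norm_mul, Complex.norm_real, Real.norm_of_nonneg (Real.sqrt_nonneg _),
    norm_pow]
  exact mul_le_of_le_one_right (Real.sqrt_nonneg _) (pow_le_one₀ (norm_nonneg _) hw.le)

lemma integral_conj_diskMonomial_mul (m n : ℕ) :
    ∫ w, conj (diskMonomial m w) * diskMonomial n w ∂diskArea = if m = n then 1 else 0 := by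
  have h := integral_diskArea_monomial 0 n m
  have e : ∀ w : ℂ, conj (diskMonomial m w) * diskMonomial n w
      = ((√((m : ℝ) + 1) : ℂ) * (√((n : ℝ) + 1) : ℂ)) * ((‖w‖ : ℂ) ^ 0 * (w ^ n * conj w ^ m)) :=
    fun w => by
      simp only [diskMonomial, map_mul, map_pow, Complex.conj_ofReal]
      ring
  simp_rw [e]
  rw [integral_const_mul, h]
  by_cases hmn : m = n
  · subst hmn
    simp only [if_true]
    rw [← Complex.ofReal_mul, Real.mul_self_sqrt (by positivity), ← Complex.ofReal_mul]
    have : ((m : ℝ) + 1) * (2 / (((0 : ℕ) : ℝ) + 2 * m + 2)) = 1 := by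
      push_cast; field_simp; ring
    rw [this, Complex.ofReal_one]
  · rw [if_neg hmn, if_neg (fun h => hmn h.symm), mul_zero]

lemma orthonormal_diskMonomial :
    Orthonormal ℂ fun n => (memLp_diskMonomial n 2).toLp (diskMonomial n) := by
  rw [orthonormal_iff_ite]
  intro m n
  rw [← integral_conj_diskMonomial_mul m n, L2.inner_def]
  refine integral_congr_ae ?_
  filter_upwards [(memLp_diskMonomial m 2).coeFn_toLp, (memLp_diskMonomial n 2).coeFn_toLp]
    with w h1 h2
  rw [h1, h2, RCLike.inner_apply, mul_comm]

/-- Bessel's inequality for the monomials. -/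
lemma sum_norm_J0AdjCoeff_sq_le {f : ℂ → ℂ} (hf : MemLp f 2 diskArea) (N : ℕ) :
    ∑ n ∈ Finset.range N, ((n : ℝ) + 2) * ‖J0AdjCoeff f n‖ ^ 2
      ≤ (eLpNorm f 2 diskArea).toReal ^ 2 := by
  have hinj : Function.Injective (fun n : ℕ => n + 1) := add_left_injective 1
  have h := (orthonormal_diskMonomial.comp _ hinj).sum_inner_products_le (hf.toLp f)
    (s := Finset.range N)
  rw [Lp.norm_toLp] at h
  refine le_trans (Finset.sum_le_sum fun n _ => le_of_eq ?_) h
  have hin : inner ℂ ((memLp_diskMonomial (n + 1) 2).toLp (diskMonomial (n + 1))) (hf.toLp f)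
      = (√((n : ℝ) + 2) : ℂ) * J0AdjCoeff f n := by
    rw [L2.inner_def, J0AdjCoeff, ← integral_const_mul]
    refine integral_congr_ae ?_
    filter_upwards [(memLp_diskMonomial (n + 1) 2).coeFn_toLp, hf.coeFn_toLp] with w h1 h2
    rw [h1, h2, RCLike.inner_apply, diskMonomial]
    simp only [map_mul, map_pow, Complex.conj_ofReal]
    push_cast
    rw [show (n : ℝ) + 1 + 1 = n + 2 by ring]
    ring
  simp only [Function.comp]
  rw [hin, norm_mul, mul_pow, Complex.norm_real, Real.norm_of_nonneg (Real.sqrt_nonneg _),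
    Real.sq_sqrt (by positivity)]

lemma integral_norm_sum_sq (a : ℕ → ℂ) (N : ℕ) :
    ∫ z, ‖∑ n ∈ Finset.range N, a n * z ^ n‖ ^ 2 ∂diskArea
      = ∑ n ∈ Finset.range N, ‖a n‖ ^ 2 / ((n : ℝ) + 1) := by
  set b : ℕ → ℂ := fun n => if n ∈ Finset.range N then a n else 0 with hb
  have hb0 : ∀ n, n ∉ Finset.range N → b n = 0 := fun n hn => if_neg hn
  have h := hasSum_integral_diskArea_norm_tsum_sq 0 (b := b)
    (summable_of_ne_finset_zero (s := Finset.range N) fun n hn => by rw [hb0 n hn, norm_zero])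
  have h2 := h.unique (hasSum_sum_of_ne_finset_zero (s := Finset.range N) fun n hn => by
    rw [hb0 n hn, norm_zero]; simp)
  have e : ∀ z : ℂ, ∑' n, b n * z ^ n = ∑ n ∈ Finset.range N, a n * z ^ n := fun z => by
    rw [tsum_eq_sum (s := Finset.range N) fun n hn => by rw [hb0 n hn, zero_mul]]
    exact Finset.sum_congr rfl fun n hn => by rw [hb]; simp only [if_pos hn]
  simp only [e, pow_zero, one_mul] at h2
  rw [h2]
  refine Finset.sum_congr rfl fun n hn => ?_
  rw [hb]
  simp only [if_pos hn]
  push_cast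
  field_simp
  ring

/-- The power series of `J₀*[f]` converges pointwise, so Fatou's lemma reduces the bound to its
partial sums, whose norms are controlled by Bessel's inequality. -/
lemma eLpNorm_two_J0Adj_le {f : ℂ → ℂ} (hf : MemLp f 2 diskArea) :
    eLpNorm (J0Adj f) 2 diskArea
      ≤ ENNReal.ofReal ((1 / 2 : ℝ) ^ (1 / 2 : ℝ)) * eLpNorm f 2 diskArea := by
  set S : ℕ → ℂ → ℂ := fun N z => ∑ n ∈ Finset.range N, J0AdjCoeff f n * z ^ n with hS
  have hSc : ∀ N, Continuous (S N) := fun N => by fun_prop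
  have hSm : ∀ N, MemLp (S N) 2 diskArea := fun N =>
    (memLp_two_iff_integrable_sq_norm (hSc N).aestronglyMeasurable).2
      (integrable_diskArea_of_continuous (by fun_prop))
  have hbd : ∀ N, eLpNorm (S N) 2 diskArea
      ≤ ENNReal.ofReal ((1 / 2 : ℝ) ^ (1 / 2 : ℝ)) * eLpNorm f 2 diskArea := fun N => by
    rw [← ENNReal.ofReal_toReal (hSm N).2.ne, ← ENNReal.ofReal_toReal hf.2.ne,
      ← ENNReal.ofReal_mul (by positivity)]
    refine ENNReal.ofReal_le_ofReal (le_of_sq_le_sq ?_ (by positivity))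
    rw [sq_toReal_eLpNorm_two (hSm N), mul_pow, ← Real.sqrt_eq_rpow, Real.sq_sqrt (by norm_num)]
    simp only [hS]
    rw [integral_norm_sum_sq]
    refine le_trans (Finset.sum_le_sum (fun n _ => ?_))
      ((Finset.mul_sum _ _ _).symm.le.trans (mul_le_mul_of_nonneg_left
        (sum_norm_J0AdjCoeff_sq_le hf N) (by norm_num)))
    -- `1 / (n + 1) ≤ (n + 2) / 2`
    rw [div_le_iff₀ (by positivity)]
    have h1 : (0 : ℝ) ≤ n := n.cast_nonneg
    have h2 := sq_nonneg ‖J0AdjCoeff f n‖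
    nlinarith [mul_nonneg h1 h2, mul_nonneg (mul_nonneg h1 h1) h2]
  have hlim : ∀ᵐ z ∂diskArea, Filter.Tendsto (fun N => S N z) Filter.atTop (nhds (J0Adj f z)) := by
    filter_upwards [ae_diskArea_norm_lt_one] with z hz
    exact (hasSum_J0Adj (hf.integrable one_le_two) hz).tendsto_sum_nat
  refine (Lp.eLpNorm_lim_le_liminf_eLpNorm (fun N => (hSc N).aestronglyMeasurable) _ hlim).trans ?_
  exact Filter.liminf_le_of_frequently_le' (Filter.Frequently.of_forall hbd)

lemma eLpNorm_diskMonomial_two (n : ℕ) : eLpNorm (diskMonomial n) 2 diskArea = 1 := by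
  rw [← Lp.enorm_toLp (memLp_diskMonomial n 2), ← ofReal_norm,
    orthonormal_diskMonomial.1 n, ENNReal.ofReal_one]

lemma J0Adj_diskMonomial_one {z : ℂ} (hz : ‖z‖ < 1) :
    J0Adj (diskMonomial 1) z = ((√2)⁻¹ : ℝ) := by
  have h := hasSum_J0Adj ((memLp_diskMonomial 1 1).integrable le_rfl) hz
  have hc : ∀ n : ℕ, (√((n : ℝ) + 2) : ℂ) * J0AdjCoeff (diskMonomial 1) n
      = if n = 0 then 1 else 0 := by
    intro n
    have := integral_conj_diskMonomial_mul (n + 1) 1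
    simp only [add_eq_right] at this
    rw [← this, J0AdjCoeff, ← integral_const_mul]
    refine integral_congr_ae (Filter.Eventually.of_forall fun w => ?_)
    simp only [diskMonomial, map_mul, map_pow, Complex.conj_ofReal]
    push_cast
    rw [show (n : ℝ) + 1 + 1 = n + 2 by ring]
    ring
  have h0 : ∀ n, n ≠ 0 → J0AdjCoeff (diskMonomial 1) n * z ^ n = 0 := fun n hn => by
    have := hc n
    rw [if_neg hn] at this
    have h3 : (√((n : ℝ) + 2) : ℂ) ≠ 0 := by
      exact_mod_cast (Real.sqrt_pos.2 (by positivity)).ne'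
    rw [(mul_eq_zero.1 this).resolve_left h3, zero_mul]
  rw [h.unique (hasSum_single 0 h0), pow_zero, mul_one]
  have := hc 0
  rw [if_pos rfl, Nat.cast_zero, zero_add] at this
  push_cast
  exact eq_inv_of_mul_eq_one_right this

lemma eLpNorm_two_J0Adj_diskMonomial_one :
    eLpNorm (J0Adj (diskMonomial 1)) 2 diskArea = ENNReal.ofReal ((1 / 2 : ℝ) ^ (1 / 2 : ℝ)) := by
  have h : J0Adj (diskMonomial 1) =ᵐ[diskArea] fun _ => (((√2)⁻¹ : ℝ) : ℂ) := by
    filter_upwards [ae_diskArea_norm_lt_one] with z hz using J0Adj_diskMonomial_one hz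
  rw [eLpNorm_congr_ae h, eLpNorm_const _ two_ne_zero (NeZero.ne _)]
  simp only [measure_univ, ENNReal.one_rpow, mul_one]
  rw [← ofReal_norm, Complex.norm_real, Real.norm_of_nonneg (by positivity),
    ← Real.sqrt_eq_rpow, Real.sqrt_div zero_le_one, Real.sqrt_one, one_div]

/-! ### Riesz–Thorin interpolation and the converse of Hölder's inequality -/

/-- The entire family `s ↦ a ‖a‖ ^ (s - 1)` through `a` (at `s = 1`), used to deform a simple
function; it vanishes at `a = 0` for every `s`. -/
noncomputable def powDeform (s a : ℂ) : ℂ := a * Complex.exp ((s - 1) * Real.log ‖a‖)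

lemma powDeform_one (a : ℂ) : powDeform 1 a = a := by simp [powDeform]

lemma norm_powDeform (s a : ℂ) :
    ‖powDeform s a‖ = ‖a‖ * Real.exp ((s.re - 1) * Real.log ‖a‖) := by
  rw [powDeform, norm_mul, Complex.norm_exp, Complex.re_mul_ofReal]
  simp

lemma norm_powDeform_of_ne_zero (s : ℂ) {a : ℂ} (ha : a ≠ 0) : ‖powDeform s a‖ = ‖a‖ ^ s.re := by
  have h : 0 < ‖a‖ := norm_pos_iff.2 ha
  calc ‖powDeform s a‖ = Real.exp (Real.log ‖a‖) * Real.exp ((s.re - 1) * Real.log ‖a‖) := by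
        rw [norm_powDeform, Real.exp_log h]
    _ = ‖a‖ ^ s.re := by
        rw [← Real.exp_add, Real.rpow_def_of_pos h]
        ring_nf

lemma norm_powDeform_of_pos {s : ℂ} (hs : 0 < s.re) (a : ℂ) : ‖powDeform s a‖ = ‖a‖ ^ s.re := by
  rcases eq_or_ne a 0 with rfl | ha
  · simp [powDeform, Real.zero_rpow hs.ne']
  · exact norm_powDeform_of_ne_zero s ha

lemma norm_powDeform_le_one {s : ℂ} (hs : s.re = 0) (a : ℂ) : ‖powDeform s a‖ ≤ 1 := by
  rcases eq_or_ne a 0 with rfl | ha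
  · simp [powDeform]
  · rw [norm_powDeform_of_ne_zero s ha, hs, Real.rpow_zero]

lemma norm_powDeform_le {s : ℂ} {R : ℝ} (hs : |s.re| ≤ R) (a : ℂ) :
    ‖powDeform s a‖ ≤ ‖a‖ * Real.exp ((R + 1) * |Real.log ‖a‖|) := by
  rw [norm_powDeform]
  refine mul_le_mul_of_nonneg_left (Real.exp_le_exp.2 ?_) (norm_nonneg _)
  calc (s.re - 1) * Real.log ‖a‖ ≤ |s.re - 1| * |Real.log ‖a‖| := by
        rw [← abs_mul]; exact le_abs_self _
    _ ≤ _ := by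
        gcongr
        have := abs_sub s.re 1
        rw [abs_one] at this
        linarith

/-- Applying `F` to the values of a simple function is linear in the values of `F`. -/
lemma simpleFunc_map_eq_sum {α : Type*} [MeasurableSpace α] (f : SimpleFunc α ℂ) (F : ℂ → ℂ) :
    f.map F = ∑ a ∈ f.range, F a • f.map (fun b => if b = a then 1 else 0) := by
  have hsum : ∀ (s : Finset ℂ) (G : ℂ → SimpleFunc α ℂ) (x : α),
      (∑ a ∈ s, G a) x = ∑ a ∈ s, G a x := by
    intro s G x
    induction s using Finset.cons_induction with
    | empty => rfl
    | cons a s ha ih => rw [Finset.sum_cons, Finset.sum_cons, SimpleFunc.add_apply, ih]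
  ext x
  rw [hsum]
  simp

/-- **Riesz–Thorin interpolation** between `L² × L²` and `L^∞ × L¹`, for a bilinear form on simple
functions. -/
theorem norm_le_of_bilinear_interpolation {X Y : Type*} [MeasurableSpace X] [MeasurableSpace Y]
    {μ : Measure X} {ν : Measure Y} (B : SimpleFunc X ℂ →ₗ[ℂ] SimpleFunc Y ℂ →ₗ[ℂ] ℂ) {M₀ M₁ : ℝ}
    (hM₀ : 0 ≤ M₀) (hM₁ : 0 ≤ M₁)
    (h₀ : ∀ f g, ‖B f g‖ ≤ M₀ *
      ((∫ x, ‖f x‖ ^ 2 ∂μ) ^ (1 / 2 : ℝ) * (∫ y, ‖g y‖ ^ 2 ∂ν) ^ (1 / 2 : ℝ)))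
    (h₁ : ∀ f g, (∀ x, ‖f x‖ ≤ 1) → ‖B f g‖ ≤ M₁ * ∫ y, ‖g y‖ ∂ν)
    {p q : ℝ} (hpq : p.HolderConjugate q) (hp : 2 < p) (f : SimpleFunc X ℂ) (g : SimpleFunc Y ℂ) :
    ‖B f g‖ ≤ M₀ ^ (2 / p) * M₁ ^ (1 - 2 / p) *
      ((∫ x, ‖f x‖ ^ p ∂μ) ^ (1 / p) * (∫ y, ‖g y‖ ^ q ∂ν) ^ (1 / q)) := by
  have hp0 : 0 < p := by linarith
  have hq0 : 0 < q := hpq.symm.pos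
  -- exponents affine in `ζ`: the deformed pair has moduli `(|f|^(p/2), |g|^(q/2))` on
  -- `re ζ = 0`, `(≤ 1, |g|^q)` on `re ζ = 1`, and `(f, g)` itself at `ζ = 1 - 2 / p`
  set u : ℂ → ℂ := fun ζ => (p / 2 : ℝ) * (1 - ζ) with hu
  set v : ℂ → ℂ := fun ζ => (q / 2 : ℝ) * (1 + ζ) with hv
  have hure : ∀ ζ, (u ζ).re = p / 2 * (1 - ζ.re) := fun ζ => by
    simp only [hu, Complex.re_ofReal_mul, Complex.sub_re, Complex.one_re]
  have hvre : ∀ ζ, (v ζ).re = q / 2 * (1 + ζ.re) := fun ζ => by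
    simp only [hv, Complex.re_ofReal_mul, Complex.add_re, Complex.one_re]
  set Φ : ℂ → ℂ := fun ζ => B (f.map (powDeform (u ζ))) (g.map (powDeform (v ζ))) with hΦ
  set β : ℂ → ℂ → ℂ := fun a b => B (f.map (fun c => if c = a then 1 else 0))
    (g.map (fun c => if c = b then 1 else 0)) with hβ
  have hexp : ∀ ζ, Φ ζ = ∑ a ∈ f.range, ∑ b ∈ g.range,
      powDeform (u ζ) a * (powDeform (v ζ) b * β a b) := fun ζ => by
    simp only [hΦ]
    rw [simpleFunc_map_eq_sum f, simpleFunc_map_eq_sum g, map_sum B, LinearMap.sum_apply]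
    refine Finset.sum_congr rfl fun a _ => ?_
    rw [map_sum]
    refine Finset.sum_congr rfl fun b _ => ?_
    rw [map_smul, map_smul, LinearMap.smul_apply, smul_eq_mul, smul_eq_mul]
    ring
  have hdiff : Differentiable ℂ Φ := by
    have : Φ = fun ζ => ∑ a ∈ f.range, ∑ b ∈ g.range,
      powDeform (u ζ) a * (powDeform (v ζ) b * β a b) := funext hexp
    rw [this]
    simp only [powDeform, hu, hv]
    fun_prop
  have hbdd : BddAbove ((norm ∘ Φ) '' Complex.HadamardThreeLines.verticalClosedStrip 0 1) := by
    refine ⟨∑ a ∈ f.range, ∑ b ∈ g.range, (‖a‖ * Real.exp ((p / 2 + 1) * |Real.log ‖a‖|)) *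
      ((‖b‖ * Real.exp ((q + 1) * |Real.log ‖b‖|)) * ‖β a b‖), ?_⟩
    rintro _ ⟨ζ, hζ, rfl⟩
    simp only [Complex.HadamardThreeLines.verticalClosedStrip, Set.mem_preimage, Set.mem_Icc] at hζ
    rw [Function.comp, hexp]
    refine (norm_sum_le _ _).trans (Finset.sum_le_sum fun a _ => ?_)
    refine (norm_sum_le _ _).trans (Finset.sum_le_sum fun b _ => ?_)
    rw [norm_mul, norm_mul]
    have h1 : |(u ζ).re| ≤ p / 2 := by
      rw [hure, abs_of_nonneg (mul_nonneg (by linarith) (by linarith))]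
      exact mul_le_of_le_one_right (by linarith) (by linarith)
    have h2 : |(v ζ).re| ≤ q := by
      rw [hvre, abs_of_nonneg (mul_nonneg (by linarith) (by linarith))]
      nlinarith
    exact mul_le_mul (norm_powDeform_le h1 a)
      (mul_le_mul_of_nonneg_right (norm_powDeform_le h2 b) (norm_nonneg _)) (by positivity)
      (by positivity)
  set F := ∫ x, ‖f x‖ ^ p ∂μ with hF
  set G := ∫ y, ‖g y‖ ^ q ∂ν with hG
  have hF0 : 0 ≤ F := integral_nonneg fun _ => by positivity
  have hG0 : 0 ≤ G := integral_nonneg fun _ => by positivity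
  have ha : ∀ ζ ∈ Complex.re ⁻¹' {0}, ‖Φ ζ‖ ≤ M₀ * (F ^ (1 / 2 : ℝ) * G ^ (1 / 2 : ℝ)) := by
    intro ζ hζ
    have hζ' : ζ.re = 0 := hζ
    refine (h₀ _ _).trans (le_of_eq ?_)
    have e1 : ∀ x, ‖(f.map (powDeform (u ζ))) x‖ ^ 2 = ‖f x‖ ^ p := fun x => by
      rw [SimpleFunc.map_apply, norm_powDeform_of_pos (by rw [hure, hζ']; linarith), hure, hζ',
        ← Real.rpow_natCast, ← Real.rpow_mul (norm_nonneg _)]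
      congr 1
      push_cast
      ring
    have e2 : ∀ y, ‖(g.map (powDeform (v ζ))) y‖ ^ 2 = ‖g y‖ ^ q := fun y => by
      rw [SimpleFunc.map_apply, norm_powDeform_of_pos (by rw [hvre, hζ']; linarith), hvre, hζ',
        ← Real.rpow_natCast, ← Real.rpow_mul (norm_nonneg _)]
      congr 1
      push_cast
      ring
    simp_rw [e1, e2]
    rfl
  have hb : ∀ ζ ∈ Complex.re ⁻¹' {1}, ‖Φ ζ‖ ≤ M₁ * G := by
    intro ζ hζ
    have hζ' : ζ.re = 1 := hζ
    refine (h₁ _ _ fun x => ?_).trans (le_of_eq ?_)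
    · rw [SimpleFunc.map_apply]
      exact norm_powDeform_le_one (by rw [hure, hζ']; ring) _
    · have e2 : ∀ y, ‖(g.map (powDeform (v ζ))) y‖ = ‖g y‖ ^ q := fun y => by
        rw [SimpleFunc.map_apply, norm_powDeform_of_pos (by rw [hvre, hζ']; linarith), hvre, hζ']
        congr 1
        ring
      simp_rw [e2]
      rfl
  have hθ0 : 0 ≤ 1 - 2 / p := by
    rw [sub_nonneg, div_le_one hp0]; exact hp.le
  have hp2 : 0 ≤ 2 / p := by positivity
  have key := Complex.HadamardThreeLines.norm_le_interp_of_mem_verticalClosedStrip₀₁' Φ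
    (z := ((1 - 2 / p : ℝ) : ℂ)) (by
      simp only [Complex.HadamardThreeLines.verticalClosedStrip, Set.mem_preimage,
        Complex.ofReal_re, Set.mem_Icc]
      exact ⟨hθ0, by linarith⟩) hdiff.diffContOnCl hbdd ha hb
  have hpq1 : 1 / p + 1 / q = 1 := by simpa using hpq.inv_add_inv_eq_one
  have hu1 : u ((1 - 2 / p : ℝ) : ℂ) = 1 := by
    simp only [hu]
    rw [← Complex.ofReal_one, ← Complex.ofReal_sub, ← Complex.ofReal_mul]
    congr 1
    field_simp
    ring
  have hv1 : v ((1 - 2 / p : ℝ) : ℂ) = 1 := by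
    simp only [hv]
    rw [← Complex.ofReal_one, ← Complex.ofReal_add, ← Complex.ofReal_mul]
    congr 1
    have : 1 / p = 1 - 1 / q := by linarith
    rw [show 2 / p = 2 * (1 / p) by ring, this]
    field_simp
    ring
  have hΦθ : Φ ((1 - 2 / p : ℝ) : ℂ) = B f g := by
    simp only [hΦ]
    rw [hu1, hv1]
    congr 1
    · congr 1; ext x; simp [powDeform_one]
    · ext x; simp [powDeform_one]
  rw [hΦθ, Complex.ofReal_re, sub_sub_cancel] at key
  refine key.trans (le_of_eq ?_)
  rw [Real.mul_rpow hM₀ (by positivity), Real.mul_rpow (by positivity) (by positivity),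
    Real.mul_rpow hM₁ hG0, ← Real.rpow_mul hF0, ← Real.rpow_mul hG0]
  have e1 : 1 / 2 * (2 / p) = 1 / p := by ring
  have e2 : 1 / q = 1 / p + (1 - 2 / p) := by
    rw [show 2 / p = 2 * (1 / p) by ring]; linarith
  rw [e1, e2, Real.rpow_add_of_nonneg hG0 (by positivity) hθ0]
  ring

/-- The converse of Hölder's inequality, tested on simple functions only. -/
lemma integral_norm_rpow_le_of_forall_simpleFunc {Y : Type*} [MeasurableSpace Y] {ν : Measure Y}
    [IsFiniteMeasure ν] {p q : ℝ} (hpq : p.HolderConjugate q) {h : Y → ℂ}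
    (hh : StronglyMeasurable h) {C₀ : ℝ} (hC₀ : 0 ≤ C₀) (hbd : ∀ᵐ y ∂ν, ‖h y‖ ≤ C₀)
    {C : ℝ} (hC : 0 ≤ C)
    (hpair : ∀ g : SimpleFunc Y ℂ, ‖∫ y, h y * g y ∂ν‖ ≤ C * (∫ y, ‖g y‖ ^ q ∂ν) ^ (1 / q)) :
    (∫ y, ‖h y‖ ^ p ∂ν) ^ (1 / p) ≤ C := by
  have hp0 : 0 < p := hpq.pos
  have hp1 : 1 < p := hpq.lt
  have hq0 : 0 < q := hpq.symm.pos
  -- the extremal function of Hölder's inequality; where `h y = 0` and `p < 2`, the power has the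
  -- junk value at base `0`, which the vanishing factor `conj (h y)` cancels
  set g₀ : Y → ℂ := fun y => conj (h y) * ((‖h y‖ ^ (p - 2) : ℝ) : ℂ) with hg₀
  have hnorm : ∀ y, ‖g₀ y‖ = ‖h y‖ ^ (p - 1) := fun y => by
    simp only [hg₀]
    rw [norm_mul, RCLike.norm_conj, Complex.norm_real, Real.norm_of_nonneg (by positivity)]
    rw [← Real.rpow_one_add' (norm_nonneg _) (by linarith)]
    congr 1
    ring
  have hmul : ∀ y, h y * g₀ y = ((‖h y‖ ^ p : ℝ) : ℂ) := fun y => by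
    simp only [hg₀]
    rw [← mul_assoc, Complex.mul_conj, Complex.normSq_eq_norm_sq, ← Complex.ofReal_mul]
    congr 1
    rw [← Real.rpow_natCast, ← Real.rpow_add' (norm_nonneg _) (by push_cast; linarith)]
    congr 1
    push_cast
    ring
  have hg₀m : StronglyMeasurable g₀ := by
    have h1 : Measurable h := hh.measurable
    have h2 : Measurable fun w : ℂ => (conj w : ℂ) := Complex.continuous_conj.measurable
    refine Measurable.stronglyMeasurable ?_
    simp only [hg₀]
    fun_prop
  set c := C₀ ^ (p - 1) with hc
  have hc0 : 0 ≤ c := by positivity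
  have hle : ∀ᵐ y ∂ν, ‖g₀ y‖ ≤ c := by
    filter_upwards [hbd] with y hy
    rw [hnorm]
    exact Real.rpow_le_rpow (norm_nonneg _) hy (by linarith)
  have hlim := hg₀m.tendsto_approxBounded_ae hle
  have ht1 : Filter.Tendsto (fun n => ∫ y, h y * hg₀m.approxBounded c n y ∂ν) Filter.atTop
      (nhds (∫ y, h y * g₀ y ∂ν)) := by
    refine tendsto_integral_of_dominated_convergence (fun _ => C₀ * c)
      (fun n => hh.aestronglyMeasurable.mul (SimpleFunc.aestronglyMeasurable _))
      (integrable_const _) (fun n => ?_) ?_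
    · filter_upwards [hbd] with y hy
      rw [norm_mul]
      exact mul_le_mul hy (hg₀m.norm_approxBounded_le hc0 n y) (norm_nonneg _) hC₀
    · filter_upwards [hlim] with y hy using hy.const_mul _
  have ht2 : Filter.Tendsto (fun n => ∫ y, ‖hg₀m.approxBounded c n y‖ ^ q ∂ν) Filter.atTop
      (nhds (∫ y, ‖g₀ y‖ ^ q ∂ν)) := by
    refine tendsto_integral_of_dominated_convergence (fun _ => c ^ q)
      (fun n => ?_) (integrable_const _) (fun n => ?_) ?_
    · exact ((SimpleFunc.measurable _).norm.pow_const q).aestronglyMeasurable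
    · refine Filter.Eventually.of_forall fun y => ?_
      rw [Real.norm_of_nonneg (by positivity)]
      exact Real.rpow_le_rpow (norm_nonneg _) (hg₀m.norm_approxBounded_le hc0 n y) hq0.le
    · filter_upwards [hlim] with y hy
      exact hy.norm.rpow_const (Or.inr hq0.le)
  set I := ∫ y, ‖h y‖ ^ p ∂ν with hI
  have hI0 : 0 ≤ I := integral_nonneg fun _ => by positivity
  have e1 : ∫ y, h y * g₀ y ∂ν = (I : ℂ) := by
    simp_rw [hmul]
    exact integral_complex_ofReal
  have e2 : ∫ y, ‖g₀ y‖ ^ q ∂ν = I := by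
    refine integral_congr_ae (Filter.Eventually.of_forall fun y => ?_)
    simp only [hnorm]
    rw [← Real.rpow_mul (norm_nonneg _), hpq.sub_one_mul_conj]
  rw [e1] at ht1
  rw [e2] at ht2
  have key : I ≤ C * I ^ (1 / q) := by
    have := le_of_tendsto_of_tendsto' ht1.norm
      ((ht2.rpow_const (p := 1 / q) (Or.inr (by positivity))).const_mul C)
      (fun n => hpair (hg₀m.approxBounded c n))
    rwa [Complex.norm_real, Real.norm_of_nonneg hI0] at this
  rcases hI0.eq_or_lt with h0 | hpos
  · rw [← h0, Real.zero_rpow (by positivity)]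
    exact hC
  · have hpq1 : 1 / p + 1 / q = 1 := by simpa using hpq.inv_add_inv_eq_one
    have : I ^ (1 / p) * I ^ (1 / q) ≤ C * I ^ (1 / q) := by
      rwa [← Real.rpow_add hpos, hpq1, Real.rpow_one]
    exact le_of_mul_le_mul_right this (by positivity)

/-! ### The bounds on `L^p` -/

lemma J0Adj_add {f g : ℂ → ℂ} (hf : Integrable f diskArea) (hg : Integrable g diskArea) {z : ℂ}
    (hz : ‖z‖ < 1) : J0Adj (f + g) z = J0Adj f z + J0Adj g z := by
  simp only [J0Adj, Pi.add_apply, mul_add]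
  exact integral_add (integrable_J0AdjKernel_mul hf hz) (integrable_J0AdjKernel_mul hg hz)

lemma J0Adj_sub {f g : ℂ → ℂ} (hf : Integrable f diskArea) (hg : Integrable g diskArea) {z : ℂ}
    (hz : ‖z‖ < 1) : J0Adj (f - g) z = J0Adj f z - J0Adj g z := by
  simp only [J0Adj, Pi.sub_apply, mul_sub]
  exact integral_sub (integrable_J0AdjKernel_mul hf hz) (integrable_J0AdjKernel_mul hg hz)

lemma J0Adj_smul (c : ℂ) (f : ℂ → ℂ) (z : ℂ) : J0Adj (c • f) z = c * J0Adj f z := by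
  simp only [J0Adj, Pi.smul_apply, smul_eq_mul]
  rw [← integral_const_mul]
  congr 1
  ext w
  ring

lemma norm_J0Adj_le {f : ℂ → ℂ} (hf : Integrable f diskArea) {z : ℂ} (hz : ‖z‖ < 1) :
    ‖J0Adj f z‖ ≤ 1 / (1 - ‖z‖) * ∫ w, ‖f w‖ ∂diskArea := by
  rw [← integral_const_mul]
  refine norm_integral_le_of_norm_le (hf.norm.const_mul _) ?_
  filter_upwards [ae_diskArea_norm_lt_one] with w hw
  rw [norm_mul]
  gcongr
  exact norm_J0AdjKernel_le hz hw

lemma stronglyMeasurable_J0Adj {f : ℂ → ℂ} (hf : Measurable f) : StronglyMeasurable (J0Adj f) :=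
  StronglyMeasurable.integral_prod_right'
    (f := fun p : ℂ × ℂ => J0AdjKernel p.1 p.2 * f p.2)
    (measurable_J0AdjKernel.mul (hf.comp measurable_snd)).stronglyMeasurable

lemma norm_J0Adj_le_of_norm_le {f : ℂ → ℂ} {C : ℝ}
    (hC : ∀ w, ‖f w‖ ≤ C) {z : ℂ} (hz : ‖z‖ < 1) :
    ‖J0Adj f z‖ ≤ (1 + 2 * catalanConst) / Real.pi * C := by
  have hC0 : 0 ≤ C := (norm_nonneg _).trans (hC 0)
  have hK := (integrable_J0AdjKernel_mul (integrable_const (1 : ℂ)) hz).norm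
  simp only [mul_one] at hK
  refine (norm_integral_le_of_norm_le (hK.mul_const C)
    (Filter.Eventually.of_forall fun w => ?_)).trans ?_
  · rw [norm_mul]
    gcongr
    exact hC w
  · rw [integral_mul_const]
    gcongr
    exact integral_norm_J0AdjKernel_right_le hz

lemma memLp_simpleFunc (f : SimpleFunc ℂ ℂ) (p : ℝ≥0∞) : MemLp f p diskArea :=
  SimpleFunc.memLp_of_isFiniteMeasure f p diskArea

lemma integrable_simpleFunc (f : SimpleFunc ℂ ℂ) : Integrable f diskArea :=
  (memLp_simpleFunc f 1).integrable le_rfl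

lemma memLp_top_J0Adj_simpleFunc (f : SimpleFunc ℂ ℂ) : MemLp (J0Adj f) ∞ diskArea :=
  ⟨aestronglyMeasurable_J0Adj f.measurable.aestronglyMeasurable,
    (eLpNorm_top_J0Adj_le f).trans_lt (ENNReal.mul_lt_top ENNReal.ofReal_lt_top
      (memLp_simpleFunc f ∞).2)⟩

lemma memLp_J0Adj_simpleFunc (f : SimpleFunc ℂ ℂ) (p : ℝ≥0∞) : MemLp (J0Adj f) p diskArea :=
  (memLp_top_J0Adj_simpleFunc f).mono_exponent le_top

lemma integrable_J0Adj_mul_simpleFunc (f g : SimpleFunc ℂ ℂ) :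
    Integrable (fun z => J0Adj f z * g z) diskArea :=
  (memLp_J0Adj_simpleFunc f 2).integrable_mul (memLp_simpleFunc g 2)

/-- The bilinear form `(f, g) ↦ ∫_𝔻 J₀*[f] g dA` on simple functions. -/
noncomputable def J0AdjForm : SimpleFunc ℂ ℂ →ₗ[ℂ] SimpleFunc ℂ ℂ →ₗ[ℂ] ℂ :=
  LinearMap.mk₂ ℂ (fun f g => ∫ z, J0Adj f z * g z ∂diskArea)
    (fun f₁ f₂ g => by
      rw [← integral_add (integrable_J0Adj_mul_simpleFunc _ _)
        (integrable_J0Adj_mul_simpleFunc _ _)]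
      refine integral_congr_ae ?_
      filter_upwards [ae_diskArea_norm_lt_one] with z hz
      rw [SimpleFunc.coe_add, J0Adj_add (integrable_simpleFunc _) (integrable_simpleFunc _) hz,
        add_mul])
    (fun c f g => by
      rw [smul_eq_mul, ← integral_const_mul]
      refine integral_congr_ae (Filter.Eventually.of_forall fun z => ?_)
      simp only
      rw [SimpleFunc.coe_smul, J0Adj_smul, mul_assoc])
    (fun f g₁ g₂ => by
      rw [← integral_add (integrable_J0Adj_mul_simpleFunc _ _)
        (integrable_J0Adj_mul_simpleFunc _ _)]
      refine integral_congr_ae (Filter.Eventually.of_forall fun z => ?_)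
      simp only
      rw [SimpleFunc.coe_add, Pi.add_apply, mul_add])
    (fun c f g => by
      rw [smul_eq_mul, ← integral_const_mul]
      refine integral_congr_ae (Filter.Eventually.of_forall fun z => ?_)
      simp only
      rw [SimpleFunc.coe_smul, Pi.smul_apply, smul_eq_mul]
      ring)

lemma J0AdjForm_apply (f g : SimpleFunc ℂ ℂ) :
    J0AdjForm f g = ∫ z, J0Adj f z * g z ∂diskArea := rfl

lemma norm_J0AdjForm_le_two (f g : SimpleFunc ℂ ℂ) :
    ‖J0AdjForm f g‖ ≤ (1 / 2 : ℝ) ^ (1 / 2 : ℝ) * ((∫ w, ‖f w‖ ^ 2 ∂diskArea) ^ (1 / 2 : ℝ) *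
      (∫ z, ‖g z‖ ^ 2 ∂diskArea) ^ (1 / 2 : ℝ)) := by
  have hT := memLp_J0Adj_simpleFunc f 2
  have hf := memLp_simpleFunc f 2
  have hg := memLp_simpleFunc g 2
  have h1 := integral_mul_norm_le_Lp_mul_Lq (μ := diskArea) Real.HolderConjugate.two_two
    (f := J0Adj f) (g := g) (by simpa using hT) (by simpa using hg)
  simp only [Real.rpow_two] at h1
  have h2 : (∫ z, ‖J0Adj f z‖ ^ 2 ∂diskArea) ^ (1 / 2 : ℝ)
      ≤ (1 / 2 : ℝ) ^ (1 / 2 : ℝ) * (∫ w, ‖f w‖ ^ 2 ∂diskArea) ^ (1 / 2 : ℝ) := by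
    have e : ∀ x : ℝ, 0 ≤ x → (x ^ 2) ^ (1 / 2 : ℝ) = x := fun x hx => by
      rw [← Real.sqrt_eq_rpow, Real.sqrt_sq hx]
    rw [← sq_toReal_eLpNorm_two hT, ← sq_toReal_eLpNorm_two hf, e _ ENNReal.toReal_nonneg,
      e _ ENNReal.toReal_nonneg]
    have := ENNReal.toReal_mono (ENNReal.mul_ne_top ENNReal.ofReal_ne_top hf.2.ne)
      (eLpNorm_two_J0Adj_le hf)
    rwa [ENNReal.toReal_mul, ENNReal.toReal_ofReal (by positivity)] at this
  calc ‖J0AdjForm f g‖ ≤ ∫ z, ‖J0Adj f z‖ * ‖g z‖ ∂diskArea := by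
        rw [J0AdjForm_apply]
        refine (norm_integral_le_integral_norm _).trans (le_of_eq ?_)
        simp_rw [norm_mul]
    _ ≤ _ := h1
    _ ≤ _ := by
        rw [← mul_assoc]
        gcongr

lemma norm_J0AdjForm_le_of_left_le_one (f g : SimpleFunc ℂ ℂ) (hf : ∀ w, ‖f w‖ ≤ 1) :
    ‖J0AdjForm f g‖ ≤ (1 + 2 * catalanConst) / Real.pi * ∫ z, ‖g z‖ ∂diskArea := by
  rw [← integral_const_mul, J0AdjForm_apply]
  refine norm_integral_le_of_norm_le ((integrable_simpleFunc g).norm.const_mul _) ?_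
  filter_upwards [ae_diskArea_norm_lt_one] with z hz
  rw [norm_mul]
  gcongr
  simpa using norm_J0Adj_le_of_norm_le hf hz

lemma norm_J0AdjForm_le_of_right_le_one (f g : SimpleFunc ℂ ℂ) (hg : ∀ z, ‖g z‖ ≤ 1) :
    ‖J0AdjForm f g‖ ≤ 4 / Real.pi * ∫ w, ‖f w‖ ∂diskArea := by
  have h := eLpNorm_one_J0Adj_le f.measurable.aestronglyMeasurable
  have hT := memLp_J0Adj_simpleFunc f 1
  have h2 := ENNReal.toReal_mono (ENNReal.mul_ne_top ENNReal.ofReal_ne_top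
    (memLp_simpleFunc f 1).2.ne) h
  rw [ENNReal.toReal_mul, ENNReal.toReal_ofReal (by positivity)] at h2
  simp only [eLpNorm_one_eq_lintegral_enorm] at h2
  rw [← integral_norm_eq_lintegral_enorm hT.1,
    ← integral_norm_eq_lintegral_enorm (memLp_simpleFunc f 1).1] at h2
  refine le_trans ?_ h2
  rw [J0AdjForm_apply]
  refine norm_integral_le_of_norm_le (hT.integrable le_rfl).norm
    (Filter.Eventually.of_forall fun z => ?_)
  rw [norm_mul]
  exact mul_le_of_le_one_right (norm_nonneg _) (hg z)

lemma one_add_two_mul_catalanConst_nonneg : 0 ≤ (1 + 2 * catalanConst) / Real.pi :=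
  hasSum_two_mul_invSqrtCoeff_sq_div_two_mul_add_three.nonneg fun n => by positivity

/-- A bound for the pairing of `J₀*[f]` with all simple functions bounds its `L^p` norm. -/
lemma eLpNorm_J0Adj_simpleFunc_le {p : ℝ≥0∞} {q : ℝ} (hp : p ≠ ∞)
    (hpq : p.toReal.HolderConjugate q) (f : SimpleFunc ℂ ℂ) {C : ℝ} (hC : 0 ≤ C)
    (h : ∀ g, ‖J0AdjForm f g‖ ≤ C * ((∫ w, ‖f w‖ ^ p.toReal ∂diskArea) ^ (1 / p.toReal) *
      (∫ z, ‖g z‖ ^ q ∂diskArea) ^ (1 / q))) :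
    eLpNorm (J0Adj f) p diskArea ≤ ENNReal.ofReal C * eLpNorm f p diskArea := by
  have hp0 : p ≠ 0 := by rintro rfl; simpa using hpq.pos
  obtain ⟨D, hD⟩ := f.exists_forall_norm_le
  have hD0 : 0 ≤ D := (norm_nonneg _).trans (hD 0)
  rw [(memLp_J0Adj_simpleFunc f p).eLpNorm_eq_integral_rpow_norm hp0 hp,
    (memLp_simpleFunc f p).eLpNorm_eq_integral_rpow_norm hp0 hp, ← ENNReal.ofReal_mul hC]
  refine ENNReal.ofReal_le_ofReal ?_
  simp only [← one_div]
  refine integral_norm_rpow_le_of_forall_simpleFunc hpq (stronglyMeasurable_J0Adj f.measurable)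
    (mul_nonneg one_add_two_mul_catalanConst_nonneg hD0) ?_
    (mul_nonneg hC (Real.rpow_nonneg (integral_nonneg fun _ => by positivity) _))
    fun g => (h g).trans_eq (by ring)
  filter_upwards [ae_diskArea_norm_lt_one] with z hz
  exact norm_J0Adj_le_of_norm_le hD hz

/-- Extension of a norm bound from simple functions to `L^p`, by density and Fatou's lemma. -/
lemma eLpNorm_J0Adj_le_of_simpleFunc {p : ℝ≥0∞} (hp1 : 1 ≤ p) (hp : p ≠ ∞) {C : ℝ≥0∞} (hC : C ≠ ∞)
    (h : ∀ f : SimpleFunc ℂ ℂ, eLpNorm (J0Adj f) p diskArea ≤ C * eLpNorm f p diskArea)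
    {f : ℂ → ℂ} (hf : MemLp f p diskArea) :
    eLpNorm (J0Adj f) p diskArea ≤ C * eLpNorm f p diskArea := by
  have hex : ∀ n : ℕ, ∃ g : SimpleFunc ℂ ℂ,
      eLpNorm (f - ⇑g) p diskArea < ((n : ℝ≥0∞) + 1)⁻¹ := fun n =>
    (hf.exists_simpleFunc_eLpNorm_sub_lt hp (ε := ((n : ℝ≥0∞) + 1)⁻¹)
      (ENNReal.inv_ne_zero.2 (ENNReal.add_ne_top.2
        ⟨ENNReal.natCast_ne_top n, ENNReal.one_ne_top⟩))).imp fun g hg => hg.1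
  choose g hg using hex
  have hε : Filter.Tendsto (fun n : ℕ => ((n : ℝ≥0∞) + 1)⁻¹) Filter.atTop (nhds 0) := by
    have := (Filter.tendsto_add_atTop_iff_nat 1).2 ENNReal.tendsto_inv_nat_nhds_zero
    simpa using this
  have hfi := hf.integrable hp1
  have hlim : ∀ᵐ z ∂diskArea, Filter.Tendsto (fun n => J0Adj (g n) z) Filter.atTop
      (nhds (J0Adj f z)) := by
    filter_upwards [ae_diskArea_norm_lt_one] with z hz
    have h0 : Filter.Tendsto (fun n => eLpNorm (f - ⇑(g n)) 1 diskArea) Filter.atTop (nhds 0) :=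
      tendsto_of_tendsto_of_tendsto_of_le_of_le tendsto_const_nhds hε (fun _ => zero_le)
        fun n => (eLpNorm_le_eLpNorm_of_exponent_le hp1
          (hf.1.sub (memLp_simpleFunc (g n) p).1)).trans (hg n).le
    have h1 : Filter.Tendsto (fun n => ∫ w, ‖(f - ⇑(g n)) w‖ ∂diskArea) Filter.atTop (nhds 0) := by
      have := (ENNReal.tendsto_toReal ENNReal.zero_ne_top).comp h0
      refine this.congr fun n => ?_
      rw [Function.comp, eLpNorm_one_eq_lintegral_enorm, integral_norm_eq_lintegral_enorm
        (hf.1.sub (memLp_simpleFunc (g n) p).1)]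
    rw [tendsto_iff_norm_sub_tendsto_zero]
    have h2 := h1.const_mul (1 / (1 - ‖z‖))
    rw [mul_zero] at h2
    refine squeeze_zero (fun _ => norm_nonneg _) (fun n => ?_) h2
    rw [norm_sub_rev, ← J0Adj_sub hfi (integrable_simpleFunc _) hz]
    exact norm_J0Adj_le (hfi.sub (integrable_simpleFunc _)) hz
  refine (Lp.eLpNorm_lim_le_liminf_eLpNorm
    (fun n => (memLp_J0Adj_simpleFunc (g n) p).1) _ hlim).trans ?_
  have ht : Filter.Tendsto (fun n : ℕ => C * (eLpNorm f p diskArea + ((n : ℝ≥0∞) + 1)⁻¹))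
      Filter.atTop (nhds (C * (eLpNorm f p diskArea + 0))) :=
    ENNReal.Tendsto.const_mul (tendsto_const_nhds.add hε) (Or.inr hC)
  rw [add_zero] at ht
  rw [← ht.liminf_eq]
  refine Filter.liminf_le_liminf (Filter.Eventually.of_forall fun n => (h (g n)).trans ?_)
  refine mul_le_mul_right ?_ C
  calc eLpNorm (g n) p diskArea = eLpNorm (f - (f - ⇑(g n))) p diskArea := by rw [sub_sub_cancel]
    _ ≤ eLpNorm f p diskArea + eLpNorm (f - ⇑(g n)) p diskArea :=
        eLpNorm_sub_le hf.1 (hf.1.sub (memLp_simpleFunc (g n) p).1) hp1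
    _ ≤ _ := by gcongr; exact (hg n).le

lemma eLpNorm_J0Adj_le_upperBoundGeTwo {p : ℝ≥0∞} (hp : 2 ≤ p) {f : ℂ → ℂ}
    (hf : MemLp f p diskArea) :
    eLpNorm (J0Adj f) p diskArea ≤ ENNReal.ofReal (upperBoundGeTwo p) * eLpNorm f p diskArea := by
  rcases eq_or_ne p ∞ with rfl | htop
  · simpa [upperBoundGeTwo] using eLpNorm_top_J0Adj_le f
  rcases hp.eq_or_lt with rfl | hlt
  · simpa [upperBoundGeTwo] using eLpNorm_two_J0Adj_le hf
  refine eLpNorm_J0Adj_le_of_simpleFunc (one_le_two.trans hp) htop ENNReal.ofReal_ne_top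
    (fun f => ?_) hf
  have hp2 : 2 < p.toReal := by
    simpa using (ENNReal.toReal_lt_toReal ENNReal.ofNat_ne_top htop).2 hlt
  have hpq := Real.HolderConjugate.conjExponent (show 1 < p.toReal by linarith)
  have hA := one_add_two_mul_catalanConst_nonneg
  have hC : upperBoundGeTwo p = ((1 / 2 : ℝ) ^ (1 / 2 : ℝ)) ^ (2 / p.toReal) *
      ((1 + 2 * catalanConst) / Real.pi) ^ (1 - 2 / p.toReal) := by
    rw [upperBoundGeTwo, ← Real.rpow_mul (by norm_num), ENNReal.toReal_div, ENNReal.toReal_one]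
    congr 2
    · ring
    · ring
  refine eLpNorm_J0Adj_simpleFunc_le htop hpq f (by rw [hC]; positivity) fun g => ?_
  rw [hC]
  exact norm_le_of_bilinear_interpolation J0AdjForm (by positivity) hA
    norm_J0AdjForm_le_two norm_J0AdjForm_le_of_left_le_one hpq hp2 f g

lemma eLpNorm_J0Adj_le_upperBoundLeTwo {p : ℝ≥0∞} (hp1 : 1 ≤ p) (hp : p ≤ 2) {f : ℂ → ℂ}
    (hf : MemLp f p diskArea) :
    eLpNorm (J0Adj f) p diskArea ≤ ENNReal.ofReal (upperBoundLeTwo p) * eLpNorm f p diskArea := by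
  have htop : p ≠ ∞ := (hp.trans_lt (by finiteness)).ne
  rcases hp1.eq_or_lt with rfl | hlt1
  · have e : upperBoundLeTwo 1 = 4 / Real.pi := by
      norm_num [upperBoundLeTwo]
    rw [e]
    exact eLpNorm_one_J0Adj_le hf.1
  rcases hp.eq_or_lt with rfl | hlt
  · have e : upperBoundLeTwo 2 = (1 / 2 : ℝ) ^ (1 / 2 : ℝ) := by
      norm_num [upperBoundLeTwo]
    rw [e]
    exact eLpNorm_two_J0Adj_le hf
  refine eLpNorm_J0Adj_le_of_simpleFunc hp1 htop ENNReal.ofReal_ne_top (fun f => ?_) hf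
  have hp2 : p.toReal < 2 := by
    simpa using (ENNReal.toReal_lt_toReal htop ENNReal.ofNat_ne_top).2 hlt
  have hp1' : 1 < p.toReal := by
    simpa using (ENNReal.toReal_lt_toReal ENNReal.one_ne_top htop).2 hlt1
  have hpq := Real.HolderConjugate.conjExponent hp1'
  set q := p.toReal.conjExponent with hq
  have hinv : 1 / q = 1 - 1 / p.toReal := by
    have := hpq.inv_add_inv_eq_one
    simp only [one_div]
    linarith
  have hq2 : 2 < q := by
    have h1 : 1 / q < 1 / 2 := by
      have : 1 / 2 < 1 / p.toReal := one_div_lt_one_div_of_lt (by linarith) hp2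
      linarith
    exact (one_div_lt_one_div hpq.symm.pos two_pos).1 h1
  have hC : upperBoundLeTwo p = ((1 / 2 : ℝ) ^ (1 / 2 : ℝ)) ^ (2 / q) *
      (4 / Real.pi) ^ (1 - 2 / q) := by
    rw [upperBoundLeTwo, ← Real.rpow_mul (by norm_num), ENNReal.toReal_div, ENNReal.toReal_one,
      show 2 / q = 2 * (1 / q) by ring, hinv]
    congr 2
    · ring
    · ring
  refine eLpNorm_J0Adj_simpleFunc_le htop hpq f (by rw [hC]; positivity) fun g => ?_
  rw [hC]
  -- the roles of the two arguments are exchanged, since `q` is the exponent above `2`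
  have h := norm_le_of_bilinear_interpolation J0AdjForm.flip (μ := diskArea) (ν := diskArea)
    (M₀ := (1 / 2 : ℝ) ^ (1 / 2 : ℝ)) (M₁ := 4 / Real.pi) (by positivity) (by positivity)
    (fun g f => (norm_J0AdjForm_le_two f g).trans_eq (by ring))
    (fun g f hg => norm_J0AdjForm_le_of_right_le_one f g hg) hpq.symm hq2 g f
  exact h.trans_eq (by ring)

/-! ### Sharpness at the endpoints -/

lemma LpOpNorm_le {p : ℝ≥0∞} {T : (ℂ → ℂ) → (ℂ → ℂ)} {C : ℝ≥0∞}
    (h : ∀ f, MemLp f p diskArea → eLpNorm (T f) p diskArea ≤ C * eLpNorm f p diskArea) :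
    LpOpNorm p T ≤ C :=
  iSup_le fun f => iSup_le fun hf => iSup_le fun h1 => (h f hf).trans_eq (by rw [h1, mul_one])

lemma le_LpOpNorm {p : ℝ≥0∞} (T : (ℂ → ℂ) → (ℂ → ℂ)) {f : ℂ → ℂ} (hf : MemLp f p diskArea)
    (h1 : eLpNorm f p diskArea = 1) : eLpNorm (T f) p diskArea ≤ LpOpNorm p T :=
  le_iSup_of_le f (le_iSup_of_le hf (le_iSup_of_le h1 le_rfl))

/-- A property true almost everywhere on the disk holds arbitrarily close to each of its points. -/
lemma frequently_nhds_of_ae_diskArea {P : ℂ → Prop} (h : ∀ᵐ z ∂diskArea, P z) {z₀ : ℂ}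
    (hz₀ : ‖z₀‖ < 1) : ∃ᶠ z in nhds z₀, P z := by
  have h1 : ∀ᵐ z ∂(volume.restrict (Metric.ball (0 : ℂ) 1)), P z := by
    have hc : ENNReal.ofReal (1 / Real.pi) ≠ 0 := by
      rw [Ne, ENNReal.ofReal_eq_zero, not_le]
      exact one_div_pos.2 Real.pi_pos
    exact (Measure.ae_ennreal_smul_measure_iff hc).1 h
  rw [ae_restrict_iff' Metric.isOpen_ball.measurableSet] at h1
  have h2 := mem_closure_iff_frequently.1 (Measure.dense_of_ae h1 z₀)
  have h3 : ∀ᶠ z in nhds z₀, z ∈ Metric.ball (0 : ℂ) 1 :=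
    Metric.isOpen_ball.mem_nhds (by simpa using hz₀)
  exact (h2.and_eventually h3).mono fun z hz => hz.1 hz.2

lemma diskArea_ne_zero_of_mem_nhds {U : Set ℂ} {z₀ : ℂ} (hU : U ∈ nhds z₀) (hz₀ : ‖z₀‖ < 1) :
    diskArea U ≠ 0 := by
  intro h
  obtain ⟨z, hz, hzU⟩ := ((frequently_nhds_of_ae_diskArea
    (measure_eq_zero_iff_ae_notMem.1 h) hz₀).and_eventually hU).exists
  exact hz hzU

lemma one_sub_conj_mul_ne_zero {z w : ℂ} (hz : ‖z‖ < 1) (hw : ‖w‖ < 1) : 1 - conj w * z ≠ 0 := by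
  rw [← norm_pos_iff]
  exact lt_of_lt_of_le (by linarith) (one_sub_norm_le_norm_one_sub_conj_mul hw)

lemma continuousAt_J0Adj {f : ℂ → ℂ} (hf : Integrable f diskArea) {z₀ : ℂ} (hz₀ : ‖z₀‖ < 1) :
    ContinuousAt (J0Adj f) z₀ := by
  have hev : ∀ᶠ z in nhds z₀, ‖z‖ < (1 + ‖z₀‖) / 2 :=
    (continuous_norm.tendsto z₀).eventually_lt_const (by linarith)
  refine continuousAt_of_dominated (bound := fun w => 2 / (1 - ‖z₀‖) * ‖f w‖) ?_ ?_
    (hf.norm.const_mul _) ?_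
  · exact Filter.Eventually.of_forall fun z =>
      (measurable_J0AdjKernel_right z).aestronglyMeasurable.mul hf.1
  · filter_upwards [hev] with z hz
    filter_upwards [ae_diskArea_norm_lt_one] with w hw
    rw [norm_mul]
    gcongr
    refine (norm_J0AdjKernel_le (by linarith) hw).trans ?_
    rw [div_le_div_iff₀ (by linarith) (by linarith)]
    linarith
  · filter_upwards [ae_diskArea_norm_lt_one] with w hw
    refine ContinuousAt.mul ?_ continuousAt_const
    exact ContinuousAt.div continuousAt_const (by fun_prop) (one_sub_conj_mul_ne_zero hz₀ hw)

/-- The extremal function for the value of `J₀*` at `z₀`: a unimodular function aligned with the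
kernel. -/
noncomputable def J0AdjPhase (z₀ w : ℂ) : ℂ :=
  if J0AdjKernel z₀ w = 0 then 1 else conj (J0AdjKernel z₀ w) / ‖J0AdjKernel z₀ w‖

lemma norm_J0AdjPhase (z₀ w : ℂ) : ‖J0AdjPhase z₀ w‖ = 1 := by
  rw [J0AdjPhase]
  split_ifs with h
  · exact norm_one
  · rw [norm_div, RCLike.norm_conj, Complex.norm_real, norm_norm, div_self (norm_ne_zero_iff.2 h)]

lemma J0AdjKernel_mul_J0AdjPhase (z₀ w : ℂ) :
    J0AdjKernel z₀ w * J0AdjPhase z₀ w = ‖J0AdjKernel z₀ w‖ := by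
  rw [J0AdjPhase]
  split_ifs with h
  · simp [h]
  · have h1 : (‖J0AdjKernel z₀ w‖ : ℂ) ≠ 0 := by exact_mod_cast norm_ne_zero_iff.2 h
    rw [mul_div_assoc', Complex.mul_conj, Complex.normSq_eq_norm_sq]
    push_cast
    field_simp

lemma measurable_J0AdjPhase (z₀ : ℂ) : Measurable (J0AdjPhase z₀) := by
  have h1 := measurable_J0AdjKernel_right z₀
  have h2 : Measurable fun w : ℂ => (conj w : ℂ) := Complex.continuous_conj.measurable
  refine Measurable.ite (h1 (measurableSet_singleton 0)) measurable_const ?_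
  exact (h2.comp h1).div (Complex.measurable_ofReal.comp h1.norm)

lemma memLp_J0AdjPhase (z₀ : ℂ) (p : ℝ≥0∞) : MemLp (J0AdjPhase z₀) p diskArea :=
  MemLp.of_bound (measurable_J0AdjPhase z₀).aestronglyMeasurable 1
    (Filter.Eventually.of_forall fun w => (norm_J0AdjPhase z₀ w).le)

/-- The image of the aligned phase takes the value `∫ |K(z₀, w)| dA(w)` at `z₀`; by continuity the
essential supremum is at least that value. -/
lemma ofReal_integral_right_le_LpOpNorm_top {z₀ : ℂ} (hz₀ : ‖z₀‖ < 1) :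
    ENNReal.ofReal (∫ w, ‖J0AdjKernel z₀ w‖ ∂diskArea) ≤ LpOpNorm ∞ J0Adj := by
  have h1 : eLpNorm (J0AdjPhase z₀) ∞ diskArea = 1 := by
    rw [eLpNorm_congr_norm_ae (g := fun _ => (1 : ℂ))
      (Filter.Eventually.of_forall fun w => by simp [norm_J0AdjPhase]),
      eLpNorm_const _ ENNReal.top_ne_zero (NeZero.ne _)]
    simp
  refine le_trans ?_ (le_LpOpNorm J0Adj (memLp_J0AdjPhase z₀ ∞) h1)
  have hval : J0Adj (J0AdjPhase z₀) z₀ = ((∫ w, ‖J0AdjKernel z₀ w‖ ∂diskArea : ℝ) : ℂ) := by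
    rw [J0Adj, ← integral_complex_ofReal]
    simp_rw [J0AdjKernel_mul_J0AdjPhase]
  have hval' : ENNReal.ofReal (∫ w, ‖J0AdjKernel z₀ w‖ ∂diskArea)
      = ‖J0Adj (J0AdjPhase z₀) z₀‖ₑ := by
    rw [hval, ← ofReal_norm, Complex.norm_real,
      Real.norm_of_nonneg (integral_nonneg fun _ => norm_nonneg _)]
  rw [hval', eLpNorm_exponent_top]
  exact le_of_tendsto_of_frequently
    ((continuousAt_J0Adj ((memLp_J0AdjPhase z₀ 1).integrable le_rfl) hz₀).enorm)
    (frequently_nhds_of_ae_diskArea (enorm_ae_le_eLpNormEssSup _ _) hz₀)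

lemma continuousAt_J0AdjKernel_right {z w₀ : ℂ} (hz : ‖z‖ < 1) (hw₀ : ‖w₀‖ < 1) :
    ContinuousAt (J0AdjKernel z) w₀ := by
  have h : Continuous fun w : ℂ => (conj w : ℂ) := Complex.continuous_conj
  exact ContinuousAt.div h.continuousAt (by fun_prop) (one_sub_conj_mul_ne_zero hz hw₀)

/-- As the disks shrink to `w₀`, the images of their normalized indicators converge pointwise to
`K(·, w₀)`, and Fatou's lemma bounds the `L¹` norm of the limit. -/
lemma ofReal_integral_left_le_LpOpNorm_one {w₀ : ℂ} (hw₀ : ‖w₀‖ < 1) :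
    ENNReal.ofReal (∫ z, ‖J0AdjKernel z w₀‖ ∂diskArea) ≤ LpOpNorm 1 J0Adj := by
  -- normalized indicators of small disks around `w₀`
  set U : ℕ → Set ℂ := fun n => Metric.ball w₀ (1 / ((n : ℝ) + 1)) with hU
  have hUm : ∀ n, MeasurableSet (U n) := fun n => Metric.isOpen_ball.measurableSet
  have hU0 : ∀ n, diskArea (U n) ≠ 0 := fun n =>
    diskArea_ne_zero_of_mem_nhds (Metric.ball_mem_nhds w₀ (by positivity)) hw₀
  set f : ℕ → ℂ → ℂ := fun n => (U n).indicator fun _ => ((diskArea.real (U n))⁻¹ : ℂ) with hf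
  have hfm : ∀ n, MemLp (f n) 1 diskArea := fun n =>
    memLp_indicator_const 1 (hUm n) _ (Or.inr (measure_ne_top _ _))
  have hf1 : ∀ n, eLpNorm (f n) 1 diskArea = 1 := fun n => by
    rw [hf, eLpNorm_indicator_const (hUm n) one_ne_zero ENNReal.one_ne_top, ← ofReal_norm,
      norm_inv, Complex.norm_real, Real.norm_of_nonneg measureReal_nonneg, Measure.real,
      ENNReal.ofReal_inv_of_pos (ENNReal.toReal_pos (hU0 n) (measure_ne_top _ _)),
      ENNReal.ofReal_toReal (measure_ne_top _ _)]
    simpa using ENNReal.inv_mul_cancel (hU0 n) (measure_ne_top _ _)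
  have hTf : ∀ n z, J0Adj (f n) z = ⨍ w in U n, J0AdjKernel z w ∂diskArea := fun n z => by
    have : ∀ w, J0AdjKernel z w * f n w = (U n).indicator
        (fun w => J0AdjKernel z w * ((diskArea.real (U n))⁻¹ : ℂ)) w := fun w => by
      by_cases h : w ∈ U n <;> simp [hf, h]
    rw [J0Adj]
    simp_rw [this]
    rw [integral_indicator (hUm n), integral_mul_const, setAverage_eq, Complex.real_smul, mul_comm]
    push_cast
    rfl
  have hlim : ∀ᵐ z ∂diskArea, Filter.Tendsto (fun n => J0Adj (f n) z) Filter.atTop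
      (nhds (J0AdjKernel z w₀)) := by
    filter_upwards [ae_diskArea_norm_lt_one] with z hz
    have hint : Integrable (J0AdjKernel z) diskArea := by
      simpa using integrable_J0AdjKernel_mul (integrable_const (1 : ℂ)) hz
    rw [(Metric.nhds_basis_closedBall).tendsto_right_iff]
    intro δ hδ
    obtain ⟨ε, hε, hball⟩ := Metric.mem_nhds_iff.1
      ((continuousAt_J0AdjKernel_right hz hw₀).preimage_mem_nhds (Metric.closedBall_mem_nhds _ hδ))
    filter_upwards [(tendsto_one_div_add_atTop_nhds_zero_nat (𝕜 := ℝ)).eventually_lt_const hε]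
      with n hn
    rw [hTf]
    refine (convex_closedBall _ _).set_average_mem Metric.isClosed_closedBall (hU0 n)
      (measure_ne_top _ _) ?_ hint.integrableOn
    filter_upwards [ae_restrict_mem (hUm n)] with w hw
    exact hball (Metric.ball_subset_ball hn.le hw)
  have hH : ENNReal.ofReal (∫ z, ‖J0AdjKernel z w₀‖ ∂diskArea)
      = eLpNorm (fun z => J0AdjKernel z w₀) 1 diskArea := by
    rw [eLpNorm_one_eq_lintegral_enorm,
      ofReal_integral_norm_eq_lintegral_enorm (integrable_J0AdjKernel_left hw₀)]
  rw [hH]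
  refine (Lp.eLpNorm_lim_le_liminf_eLpNorm (fun n => aestronglyMeasurable_J0Adj (hfm n).1) _
    hlim).trans ?_
  exact Filter.liminf_le_of_frequently_le'
    (Filter.Frequently.of_forall fun n => le_LpOpNorm J0Adj (hfm n) (hf1 n))

theorem corollary2 :
    -- `J₀*` maps `L^p(𝔻)` into itself for every `1 ≤ p ≤ ∞`
    (∀ p : ℝ≥0∞, 1 ≤ p → ∀ f : ℂ → ℂ, MemLp f p diskArea → MemLp (J0Adj f) p diskArea) ∧
    -- the norm estimates
    (∀ p : ℝ≥0∞, 2 ≤ p → LpOpNorm p J0Adj ≤ ENNReal.ofReal (upperBoundGeTwo p)) ∧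
    (∀ p : ℝ≥0∞, 1 ≤ p → p ≤ 2 → LpOpNorm p J0Adj ≤ ENNReal.ofReal (upperBoundLeTwo p)) ∧
    -- equality for `p = 1`, `p = 2` and `p = ∞`
    LpOpNorm 1 J0Adj = ENNReal.ofReal (upperBoundLeTwo 1) ∧
    LpOpNorm 2 J0Adj = ENNReal.ofReal (upperBoundLeTwo 2) ∧
    LpOpNorm 2 J0Adj = ENNReal.ofReal (upperBoundGeTwo 2) ∧
    LpOpNorm ∞ J0Adj = ENNReal.ofReal (upperBoundGeTwo ∞) := by
  have hge : ∀ p : ℝ≥0∞, 2 ≤ p → LpOpNorm p J0Adj ≤ ENNReal.ofReal (upperBoundGeTwo p) :=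
    fun p hp => LpOpNorm_le fun f hf => eLpNorm_J0Adj_le_upperBoundGeTwo hp hf
  have hle : ∀ p : ℝ≥0∞, 1 ≤ p → p ≤ 2 → LpOpNorm p J0Adj ≤ ENNReal.ofReal (upperBoundLeTwo p) :=
    fun p hp1 hp => LpOpNorm_le fun f hf => eLpNorm_J0Adj_le_upperBoundLeTwo hp1 hp hf
  have hIoo : Set.Ioo (0 : ℝ) 1 ∈ nhdsWithin 1 (Set.Iio 1) := Ioo_mem_nhdsLT one_pos
  have hnorm : ∀ r ∈ Set.Ioo (0 : ℝ) 1, ‖(r : ℂ)‖ < 1 := fun r hr => by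
    rw [Complex.norm_real, Real.norm_of_nonneg hr.1.le]
    exact hr.2
  have h2 : ENNReal.ofReal ((1 / 2 : ℝ) ^ (1 / 2 : ℝ)) ≤ LpOpNorm 2 J0Adj :=
    eLpNorm_two_J0Adj_diskMonomial_one.symm.le.trans
      (le_LpOpNorm J0Adj (memLp_diskMonomial 1 2) (eLpNorm_diskMonomial_two 1))
  have e1 : upperBoundLeTwo 1 = 4 / Real.pi := by norm_num [upperBoundLeTwo]
  have e2 : upperBoundLeTwo 2 = (1 / 2 : ℝ) ^ (1 / 2 : ℝ) := by norm_num [upperBoundLeTwo]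
  have e2' : upperBoundGeTwo 2 = (1 / 2 : ℝ) ^ (1 / 2 : ℝ) := by norm_num [upperBoundGeTwo]
  have etop : upperBoundGeTwo ∞ = (1 + 2 * catalanConst) / Real.pi := by
    norm_num [upperBoundGeTwo]
  refine ⟨fun p hp f hf => ⟨aestronglyMeasurable_J0Adj hf.1, ?_⟩, hge, hle,
    (hle 1 le_rfl one_le_two).antisymm ?_, (hle 2 one_le_two le_rfl).antisymm (e2 ▸ h2),
    (hge 2 le_rfl).antisymm (e2' ▸ h2), (hge ∞ le_top).antisymm ?_⟩
  · rcases le_total 2 p with h | h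
    · exact (eLpNorm_J0Adj_le_upperBoundGeTwo h hf).trans_lt
        (ENNReal.mul_lt_top ENNReal.ofReal_lt_top hf.2)
    · exact (eLpNorm_J0Adj_le_upperBoundLeTwo hp h hf).trans_lt
        (ENNReal.mul_lt_top ENNReal.ofReal_lt_top hf.2)
  · rw [e1]
    refine le_of_tendsto (ENNReal.tendsto_ofReal tendsto_integral_norm_J0AdjKernel_left) ?_
    filter_upwards [hIoo] with r hr using ofReal_integral_left_le_LpOpNorm_one (hnorm r hr)
  · rw [etop]
    refine le_of_tendsto (ENNReal.tendsto_ofReal tendsto_integral_norm_J0AdjKernel_right) ?_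
    filter_upwards [hIoo] with r hr using ofReal_integral_right_le_LpOpNorm_top (hnorm r hr)
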